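/- Let $X$ be a finite set of variables, let $GL(X)$ and $gl(X)$ act on $\mathrm{Sym}^d(X)$ (forms of degree $d$ over $\mathbb{C}$) by linear substitution of the variables, respectively by derivations, and let $X=Y\sqcup Z$ be a partition. Let $\lambda(t)\in GL(X)$ be the two-block one-parameter subgroup with $\lambda(t)y=y$ for $y\in Y$ and $\lambda(t)z=tz$ for $z\in Z$. Let $f,g\in \mathrm{Sym}^d(X)$ be such that \[ \lambda(t)\cdot f=t^a g+\text{(terms of higher order in } t),\qquad g\neq 0, \] that is, $g$ is the limit (leading term) of $f$ under $\lambda$, with exponent $a$. Suppose that the stabilizer of $f$ in $GL(X)$ is reductive and that the $GL(X)$-orbit of $g$ has codimension one in the orbit closure of $f$, i.e. $\dim O(f)=\dim O(g)+1$. Let $\mathcal{K},\mathcal{H}\subseteq gl(X)$ be the Lie algebra stabilizers of $f$ and $g$, and let $\mathcal{K}_0$ be the limit as $t\to 0$ of the stabilizers $\mathcal{K}(t)$ of $\lambda(t)\cdot f$, i.e. the set of all $A(0)$, where $A$ is a polynomial family in $gl(X)$ with $A(t)\in\mathcal{K}(t)$ for all $t\ne 0$. Let $\ell=\mathrm{diag}(\epsilon_x)_{x\in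 X}-\frac{a}{d}I$, with $\epsilon_x=0$ for $x\in Y$ and $\epsilon_x=1$ for $x\in Z$, be the generator of $t^{-a/d}\lambda(t)$. Let $U(\lambda)$ be the unipotent radical of $P(\lambda)=\{x\in GL(X) : \lim_{t\to 0}\lambda(t)x\lambda(t)^{-1}\text{ exists}\}$. Then at least one of the following holds: 1. $\mathcal{K}_0$ is a nilpotent Lie algebra, and $\mathcal{H}=\mathcal{K}_0\oplus\mathbb{C}\ell$ is a Levi factorization of $\mathcal{H}$: $\mathcal{K}_0$ is an ideal of $\mathcal{H}$ consisting of nilpotent matrices, and $\mathbb{C}\ell$ is a complementary subalgebra that is reductive in $gl(X)$ (it acts completely reducibly on $\mathbb{C}^X$). 2. There are a unipotent element $u\in U(\lambda)$ and a nonzero $k\in\mathcal{K}$ such that, with $f^u=u\cdot f$, the element $uku^{-1}$ stabilizes $g$, $f^u$ and $\ell f^u$ (i.e. it annihilates all three), and $g$ is the limit of $f^u$ under $\lambda$: $\lambda(t)\cdot f^u=t^a g+\text{(terms of higher order in } t)$. -/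

import Mathlib

open scoped Topology
open Filter

attribute [local instance 100] LieRing.ofAssociativeRing

noncomputable section

namespace FormLimits

/-! ### The actions of `GL(X)` and `gl(X)` on forms -/

/-- The linear form `∑ i, A i j x_i` into which the matrix `A` sends the variable `x_j`. -/
def linForm {ι : Type*} [Fintype ι] (A : Matrix ι ι ℂ) (j : ι) : MvPolynomial ι ℂ :=
  ∑ i, MvPolynomial.C (A i j) * MvPolynomial.X i

/-- The action of a matrix on polynomials by linear substitution of the variables; on invertible
matrices this is the natural left action of `GL(X)` on `Sym(X)`. -/
def subst {ι : Type*} [Fintype ι] (A : Matrix ι ι ℂ) :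
    MvPolynomial ι ℂ →ₐ[ℂ] MvPolynomial ι ℂ :=
  MvPolynomial.aeval (linForm A)

/-- The infinitesimal action of `gl(X)` on polynomials: `A` acts as the derivation
`∑ i j, A i j x_i ∂/∂x_j`. -/
def lieAct {ι : Type*} [Fintype ι] (A : Matrix ι ι ℂ) :
    Derivation ℂ (MvPolynomial ι ℂ) (MvPolynomial ι ℂ) :=
  MvPolynomial.mkDerivation ℂ (linForm A)

theorem linForm_add {ι : Type*} [Fintype ι] (A B : Matrix ι ι ℂ) (j : ι) :
    linForm (A + B) j = linForm A j + linForm B j := by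
  simp [linForm, add_mul, Finset.sum_add_distrib]

theorem linForm_smul {ι : Type*} [Fintype ι] (c : ℂ) (A : Matrix ι ι ℂ) (j : ι) :
    linForm (c • A) j = c • linForm A j := by
  simp [linForm, Finset.smul_sum, MvPolynomial.smul_eq_C_mul, mul_assoc]

theorem linForm_one {ι : Type*} [Fintype ι] [DecidableEq ι] (j : ι) :
    linForm (1 : Matrix ι ι ℂ) j = MvPolynomial.X j := by
  simp [linForm, Matrix.one_apply, apply_ite MvPolynomial.C, ite_mul]

theorem sum_linForm {ι : Type*} [Fintype ι] (A B : Matrix ι ι ℂ) (j : ι) :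
    ∑ i, MvPolynomial.C (B i j) * linForm A i = linForm (A * B) j := by
  simp only [linForm, Matrix.mul_apply, map_sum, map_mul, Finset.mul_sum, Finset.sum_mul]
  rw [Finset.sum_comm]
  refine Finset.sum_congr rfl fun i _ => Finset.sum_congr rfl fun k _ => ?_
  ring

theorem subst_one {ι : Type*} [Fintype ι] [DecidableEq ι] :
    subst (1 : Matrix ι ι ℂ) = AlgHom.id ℂ _ := by
  refine MvPolynomial.algHom_ext fun j => ?_
  simp [subst, linForm_one]

theorem subst_mul {ι : Type*} [Fintype ι] (A B : Matrix ι ι ℂ) :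
    subst (A * B) = (subst A).comp (subst B) := by
  refine MvPolynomial.algHom_ext fun j => ?_
  rw [AlgHom.comp_apply]
  simp only [subst, MvPolynomial.aeval_X]
  rw [← sum_linForm]
  conv_rhs => rw [linForm]
  simp [MvPolynomial.algebraMap_eq]

theorem lieAct_add {ι : Type*} [Fintype ι] (A B : Matrix ι ι ℂ) :
    lieAct (A + B) = lieAct A + lieAct B := by
  refine MvPolynomial.derivation_ext fun j => ?_
  simp [lieAct, linForm_add, MvPolynomial.mkDerivation_X]

theorem lieAct_smul {ι : Type*} [Fintype ι] (c : ℂ) (A : Matrix ι ι ℂ) :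
    lieAct (c • A) = c • lieAct A := by
  refine MvPolynomial.derivation_ext fun j => ?_
  simp [lieAct, linForm_smul, MvPolynomial.mkDerivation_X]

theorem lieAct_linForm {ι : Type*} [Fintype ι] (A B : Matrix ι ι ℂ) (j : ι) :
    lieAct A (linForm B j) = linForm (A * B) j := by
  rw [← sum_linForm]
  conv_lhs => rw [linForm]
  simp [lieAct, MvPolynomial.mkDerivation_X, ← MvPolynomial.smul_eq_C_mul]

theorem lieAct_lie {ι : Type*} [Fintype ι] [DecidableEq ι] (A B : Matrix ι ι ℂ) :
    lieAct ⁅A, B⁆ = ⁅lieAct A, lieAct B⁆ := by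
  refine MvPolynomial.derivation_ext fun j => ?_
  rw [Derivation.commutator_apply]
  have hX : ∀ M : Matrix ι ι ℂ, lieAct M (MvPolynomial.X j) = linForm M j := fun M =>
    MvPolynomial.mkDerivation_X ℂ _ j
  have hsub : linForm (A * B - B * A) j = linForm (A * B) j - linForm (B * A) j := by
    simp [linForm, sub_mul, Finset.sum_sub_distrib]
  rw [hX, hX, hX, lieAct_linForm, lieAct_linForm, Ring.lie_def, hsub]

/-- The stabilizer of `f` in `GL(X)`. -/
def groupStabilizer {ι : Type*} [Fintype ι] [DecidableEq ι] (f : MvPolynomial ι ℂ) :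
    Subgroup (Matrix.GeneralLinearGroup ι ℂ) where
  carrier := {A | subst (A : Matrix ι ι ℂ) f = f}
  one_mem' := by simp [subst_one]
  mul_mem' := by
    intro A B hA hB
    simp only [Set.mem_ofPred_eq, Units.val_mul, subst_mul, AlgHom.comp_apply] at *
    rw [hB, hA]
  inv_mem' := by
    intro A hA
    simp only [Set.mem_ofPred_eq] at *
    have h : subst ((A⁻¹ : Matrix.GeneralLinearGroup ι ℂ) : Matrix ι ι ℂ)
        (subst (A : Matrix ι ι ℂ) f) = f := by
      rw [← AlgHom.comp_apply, ← subst_mul, ← Units.val_mul, inv_mul_cancel, Units.val_one,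
        subst_one, AlgHom.id_apply]
    rwa [hA] at h

/-- The Lie algebra stabilizer of `f` in `gl(X)`. -/
def lieStabilizer {ι : Type*} [Fintype ι] [DecidableEq ι] (f : MvPolynomial ι ℂ) :
    LieSubalgebra ℂ (Matrix ι ι ℂ) where
  carrier := {A | lieAct A f = 0}
  zero_mem' := by
    have h := lieAct_smul (0 : ℂ) (0 : Matrix ι ι ℂ)
    simp only [zero_smul] at h
    simp [h]
  add_mem' := by
    intro A B hA hB
    simp only [Set.mem_ofPred_eq] at *
    simp [lieAct_add, hA, hB]
  smul_mem' := by
    intro c A hA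
    simp only [Set.mem_ofPred_eq] at *
    simp [lieAct_smul, hA]
  lie_mem' := by
    intro A B hA hB
    have hA' : lieAct A f = 0 := hA
    have hB' : lieAct B f = 0 := hB
    change lieAct ⁅A, B⁆ f = 0
    simp [lieAct_lie, Derivation.commutator_apply, hA', hB']

/-- The tangent space `gl(X) · f` at `f` of the orbit of `f` under `GL(X)`. -/
def orbitTangent {ι : Type*} [Fintype ι] (f : MvPolynomial ι ℂ) :
    Submodule ℂ (MvPolynomial ι ℂ) where
  carrier := {p | ∃ A : Matrix ι ι ℂ, lieAct A f = p}
  zero_mem' := ⟨0, by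
    have h := lieAct_smul (0 : ℂ) (0 : Matrix ι ι ℂ)
    simp only [zero_smul] at h
    simp [h]⟩
  add_mem' := by
    rintro _ _ ⟨A, rfl⟩ ⟨B, rfl⟩
    exact ⟨A + B, by simp [lieAct_add]⟩
  smul_mem' := by
    rintro c _ ⟨A, rfl⟩
    exact ⟨c • A, by simp [lieAct_smul]⟩

/-- The dimension of the orbit of `f` under `GL(X)`, equivalently of its closure: the orbit is a
smooth locally closed subvariety, homogeneous under `GL(X)`, with tangent space `gl(X) · f`. -/
def orbitDim {ι : Type*} [Fintype ι] (f : MvPolynomial ι ℂ) : ℕ :=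
  Module.finrank ℂ (orbitTangent f)

/-! ### Reductive groups and Levi factorizations -/

/-- Zariski closed subsets of `GL(X)`. -/
def IsZariskiClosed {ι : Type*} [Fintype ι] [DecidableEq ι]
    (S : Set (Matrix.GeneralLinearGroup ι ℂ)) : Prop :=
  ∃ P : Set (MvPolynomial (ι × ι) ℂ),
    S = {A : Matrix.GeneralLinearGroup ι ℂ | ∀ p ∈ P,
      MvPolynomial.eval (fun ij => (A : Matrix ι ι ℂ) ij.1 ij.2) p = 0}

/-- The unipotent radical of a Zariski closed subgroup `K` of `GL(X)`: the subgroup generated by all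
Zariski closed normal subgroups of `K` that consist of unipotent elements. (Over `ℂ` a Zariski
closed subgroup consisting of unipotent elements is automatically connected.) -/
def unipotentRadical {ι : Type*} [Fintype ι] [DecidableEq ι]
    (K : Subgroup (Matrix.GeneralLinearGroup ι ℂ)) : Subgroup (Matrix.GeneralLinearGroup ι ℂ) :=
  sSup {N | N ≤ K ∧ (∀ x ∈ K, ∀ n ∈ N, x * n * x⁻¹ ∈ N) ∧
    IsZariskiClosed (N : Set (Matrix.GeneralLinearGroup ι ℂ)) ∧
    ∀ n ∈ N, IsNilpotent ((n : Matrix ι ι ℂ) - 1)}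

/-- A Zariski closed subgroup of `GL(X)` is reductive if its unipotent radical is trivial. -/
def IsReductive {ι : Type*} [Fintype ι] [DecidableEq ι]
    (K : Subgroup (Matrix.GeneralLinearGroup ι ℂ)) : Prop :=
  unipotentRadical K = ⊥

/-- The Lie subalgebra `ℂ x`. -/
def line {ι : Type*} [Fintype ι] [DecidableEq ι] (x : Matrix ι ι ℂ) :
    LieSubalgebra ℂ (Matrix ι ι ℂ) :=
  { Submodule.span ℂ {x} with
    lie_mem' := by
      intro y z hy hz
      obtain ⟨c, rfl⟩ := Submodule.mem_span_singleton.1 hy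
      obtain ⟨e, rfl⟩ := Submodule.mem_span_singleton.1 hz
      simp }

/-- `H = Q ⊕ R` is a Levi factorization of the Lie algebra `H` of matrices: `Q` is an ideal of `H`
consisting of nilpotent matrices, and `R` is a complementary subalgebra which is reductive in
`gl(X)`, in the sense that the defining representation is a completely reducible `R`-module.
(These conditions force `Q` to be the largest ideal of `H` consisting of nilpotent matrices.) -/
structure IsLeviFactorization {ι : Type*} [Fintype ι] [DecidableEq ι]
    (H Q R : LieSubalgebra ℂ (Matrix ι ι ℂ)) : Prop where
  sup_eq : Q.toSubmodule ⊔ R.toSubmodule = H.toSubmodule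
  inf_eq : Q.toSubmodule ⊓ R.toSubmodule = ⊥
  ideal : ∀ x ∈ H, ∀ y ∈ Q, ⁅x, y⁆ ∈ Q
  nilpotent : ∀ y ∈ Q, IsNilpotent y
  reductive : ∀ W : Submodule ℂ (ι → ℂ), (∀ x ∈ R, ∀ w ∈ W, Matrix.mulVec x w ∈ W) →
    ∃ W' : Submodule ℂ (ι → ℂ), (∀ x ∈ R, ∀ w ∈ W', Matrix.mulVec x w ∈ W') ∧ IsCompl W W'

/-! ### Two-block one-parameter subgroups -/

/-- The two-block one-parameter subgroup `λ(t)` that multiplies the variables in `Z` by `t` and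
fixes the other variables. -/
def twoBlock {ι : Type*} [DecidableEq ι] (Z : Finset ι) (t : ℂ) : Matrix ι ι ℂ :=
  Matrix.diagonal fun i => if i ∈ Z then t else 1

/-- The generator `ℓ` of the normalized one-parameter subgroup `t ^ (-a/d) λ(t)`. -/
def ell {ι : Type*} [DecidableEq ι] (Z : Finset ι) (a d : ℕ) : Matrix ι ι ℂ :=
  Matrix.diagonal fun i => (if i ∈ Z then 1 else 0) - (a : ℂ) / (d : ℂ)

/-- `g` is the limit (leading term) of `f` under `λ`, with exponent `a`:
`λ(t) · f = t ^ a g + (terms of higher order in t)` with `g ≠ 0`. -/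
def IsLimit {ι : Type*} [Fintype ι] [DecidableEq ι] (Z : Finset ι) (a : ℕ)
    (f g : MvPolynomial ι ℂ) : Prop :=
  g ≠ 0 ∧ ∃ (D : ℕ) (c : ℕ → MvPolynomial ι ℂ), ∀ t : ℂ, t ≠ 0 →
    subst (twoBlock Z t) f = t ^ a • g + ∑ i ∈ Finset.Ioc a D, t ^ i • c i

/-- Specialization at `t` of a matrix with polynomial entries. -/
def specialize {ι : Type*} (A : Matrix ι ι (Polynomial ℂ)) (t : ℂ) : Matrix ι ι ℂ :=
  A.map (Polynomial.eval t)

theorem specialize_lie {ι : Type*} [Fintype ι] [DecidableEq ι]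
    (A B : Matrix ι ι (Polynomial ℂ)) (t : ℂ) :
    specialize ⁅A, B⁆ t = ⁅specialize A t, specialize B t⁆ := by
  have h : ∀ M, specialize M t = (Polynomial.evalRingHom t).mapMatrix (m := ι) M := fun M => rfl
  simp only [h, Ring.lie_def, map_sub, map_mul]

/-- The limit `𝒦₀` as `t → 0` of the stabilizers `𝒦(t)` of `f(t) = λ(t) · f`: the values at `t = 0`
of the polynomial families `A(t)` with `A(t) ∈ 𝒦(t)` for all `t ≠ 0`. -/
def limitStabilizer {ι : Type*} [Fintype ι] [DecidableEq ι] (Z : Finset ι)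
    (f : MvPolynomial ι ℂ) : LieSubalgebra ℂ (Matrix ι ι ℂ) where
  carrier := {k | ∃ A : Matrix ι ι (Polynomial ℂ),
    (∀ t : ℂ, t ≠ 0 → specialize A t ∈ lieStabilizer (subst (twoBlock Z t) f)) ∧
      specialize A 0 = k}
  zero_mem' := by
    have h : ∀ t : ℂ, specialize (0 : Matrix ι ι (Polynomial ℂ)) t = 0 := fun t => by
      ext i j; simp [specialize]
    exact ⟨0, fun t _ => by rw [h]; exact zero_mem _, h 0⟩
  add_mem' := by
    rintro _ _ ⟨A, hA, rfl⟩ ⟨B, hB, rfl⟩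
    have h : ∀ t : ℂ, specialize (A + B) t = specialize A t + specialize B t := fun t => by
      ext i j; simp [specialize]
    exact ⟨A + B, fun t ht => by rw [h]; exact add_mem (hA t ht) (hB t ht), h 0⟩
  smul_mem' := by
    rintro c _ ⟨A, hA, rfl⟩
    have h : ∀ t : ℂ, specialize (c • A) t = c • specialize A t := fun t => by
      ext i j; simp [specialize]
    exact ⟨c • A, fun t ht => by
      rw [h]; exact (lieStabilizer (subst (twoBlock Z t) f)).smul_mem c (hA t ht), h 0⟩
  lie_mem' := by
    rintro _ _ ⟨A, hA, rfl⟩ ⟨B, hB, rfl⟩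
    exact ⟨⁅A, B⁆, fun t ht => by
      rw [specialize_lie]; exact LieSubalgebra.lie_mem _ (hA t ht) (hB t ht),
      specialize_lie A B 0⟩

/-- The family `λ(t) x λ(t)⁻¹`. -/
def conjBy {ι : Type*} [Fintype ι] [DecidableEq ι] (Z : Finset ι) (x : Matrix ι ι ℂ) (t : ℂ) :
    Matrix ι ι ℂ :=
  twoBlock Z t * x * (twoBlock Z t)⁻¹

theorem isUnit_det_twoBlock {ι : Type*} [Fintype ι] [DecidableEq ι] (Z : Finset ι) {t : ℂ}
    (ht : t ≠ 0) : IsUnit (twoBlock Z t).det := by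
  rw [isUnit_iff_ne_zero, twoBlock, Matrix.det_diagonal, Finset.prod_ne_zero_iff]
  intro i _
  split_ifs
  · exact ht
  · exact one_ne_zero

theorem conjBy_one {ι : Type*} [Fintype ι] [DecidableEq ι] (Z : Finset ι) {t : ℂ} (ht : t ≠ 0) :
    conjBy Z 1 t = 1 := by
  rw [conjBy, mul_one, Matrix.mul_nonsing_inv _ (isUnit_det_twoBlock Z ht)]

theorem conjBy_mul {ι : Type*} [Fintype ι] [DecidableEq ι] (Z : Finset ι) (x y : Matrix ι ι ℂ)
    {t : ℂ} (ht : t ≠ 0) : conjBy Z (x * y) t = conjBy Z x t * conjBy Z y t := by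
  have h := Matrix.nonsing_inv_mul _ (isUnit_det_twoBlock Z ht)
  simp only [conjBy]
  calc twoBlock Z t * (x * y) * (twoBlock Z t)⁻¹
      = twoBlock Z t * x * 1 * y * (twoBlock Z t)⁻¹ := by simp [mul_assoc]
    _ = _ := by rw [← h]; simp [mul_assoc]

theorem conjBy_det {ι : Type*} [Fintype ι] [DecidableEq ι] (Z : Finset ι) (x : Matrix ι ι ℂ)
    {t : ℂ} (ht : t ≠ 0) : (conjBy Z x t).det = x.det := by
  have h := congrArg Matrix.det (Matrix.mul_nonsing_inv _ (isUnit_det_twoBlock Z ht))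
  rw [Matrix.det_mul, Matrix.det_one] at h
  rw [conjBy, Matrix.det_mul, Matrix.det_mul, mul_right_comm, h, one_mul]

/-- The parabolic subgroup `P(λ)`: the `x ∈ GL(X)` such that `λ(t) x λ(t)⁻¹` has a limit as
`t → 0`. -/
def parabolic {ι : Type*} [Fintype ι] [DecidableEq ι] (Z : Finset ι) :
    Subgroup (Matrix.GeneralLinearGroup ι ℂ) where
  carrier := {x | ∃ L : Matrix ι ι ℂ, Tendsto (conjBy Z (x : Matrix ι ι ℂ)) (𝓝[≠] 0) (𝓝 L)}
  one_mem' := by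
    refine ⟨1, tendsto_const_nhds.congr' ?_⟩
    filter_upwards [self_mem_nhdsWithin] with t ht
    exact (conjBy_one Z ht).symm
  mul_mem' := by
    rintro x y ⟨L, hL⟩ ⟨M, hM⟩
    refine ⟨L * M, (hL.mul hM).congr' ?_⟩
    filter_upwards [self_mem_nhdsWithin] with t ht
    exact (conjBy_mul Z _ _ ht).symm
  inv_mem' := by
    rintro x ⟨L, hL⟩
    have hdet : L.det = (x : Matrix ι ι ℂ).det := by
      have h1 : Tendsto (fun t => (conjBy Z (x : Matrix ι ι ℂ) t).det) (𝓝[≠] (0 : ℂ))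
          (𝓝 L.det) := ((continuous_id.matrix_det).tendsto L).comp hL
      refine tendsto_nhds_unique h1 (tendsto_const_nhds.congr' ?_)
      filter_upwards [self_mem_nhdsWithin] with t ht
      exact (conjBy_det Z _ ht).symm
    have hx : (x : Matrix ι ι ℂ).det ≠ 0 :=
      ((Matrix.isUnit_iff_isUnit_det _).1 x.isUnit).ne_zero
    refine ⟨(x : Matrix ι ι ℂ).det⁻¹ • L.adjugate, ?_⟩
    have h2 : Tendsto (fun t => (x : Matrix ι ι ℂ).det⁻¹ •
        (conjBy Z (x : Matrix ι ι ℂ) t).adjugate) (𝓝[≠] (0 : ℂ))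
        (𝓝 ((x : Matrix ι ι ℂ).det⁻¹ • L.adjugate)) :=
      (((continuous_id.matrix_adjugate).tendsto L).comp hL).const_smul _
    refine h2.congr' ?_
    filter_upwards [self_mem_nhdsWithin] with t ht
    have h3 : conjBy Z ((x⁻¹ : Matrix.GeneralLinearGroup ι ℂ) : Matrix ι ι ℂ) t *
        conjBy Z (x : Matrix ι ι ℂ) t = 1 := by
      rw [← conjBy_mul Z _ _ ht, ← Units.val_mul, inv_mul_cancel, Units.val_one, conjBy_one Z ht]
    rw [← Matrix.inv_eq_left_inv h3, Matrix.inv_def, conjBy_det Z _ ht, Ring.inverse_eq_inv']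

end FormLimits

end

noncomputable section

namespace FormLimits

/-! ### Linear algebra -/

/-! Let P be the projection onto the span of the variables in Z. Then ad P grades gl(X) by the
weights -1, 0, 1, conjugation by λ(t) multiplies weight w by t^w, and the Lie algebra 𝔭 of P(λ) is
the part of weights ≥ 0. The theorem is a dichotomy: either 𝒦 ∩ 𝔭 contains a matrix that is not
nilpotent, or it does not.

In the first case the semisimple part s of such a matrix is nonzero, still annihilates f, and lies
in 𝔭 because it is a polynomial in the matrix. So s preserves range P and has an invariant
complement W to it. An element u of U(λ) moves W to ker P, and then usu⁻¹ commutes with P, hence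
with λ(t) and ℓ. It annihilates f^u, therefore ℓf^u and every λ(t)f^u, and in the limit g; u itself
does not change the leading term. This is `exists_common_annihilator`, and it gives the second
alternative.

In the second case the key is `mem_limitStabilizer_iff`: 𝒦₀ is graded, and its pieces are the
leading weight components of the elements of 𝒦. Hence dim 𝒦₀ ≥ dim 𝒦, and an element of weight 0 in
𝒦₀ is the weight 0 part of an element of 𝒦 ∩ 𝔭, so it is nilpotent. A graded form of Engel's
theorem, `isNilpotent_of_graded`, makes all of 𝒦₀ nilpotent. The diagonal matrix ℓ annihilates g but
is not in 𝒦₀: it would be nilpotent, hence zero, forcing f = g. Codimension one gives dim ℋ = dim 𝒦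
+ 1, so 𝒦₀ ⊕ ℂℓ fills ℋ, and 𝒦₀ is an ideal because ad ℓ = ad P acts on it by weights. -/

/-- The coefficients of a polynomial curve that lies in a subspace lie in this subspace. -/
theorem coeff_mem_of_forall_sum_pow_smul_mem {V : Type*} [AddCommGroup V] [Module ℂ V]
    (W : Submodule ℂ V) (s : Finset ℕ) (c : ℕ → V)
    (h : ∀ t : ℂ, t ≠ 0 → ∑ i ∈ s, t ^ i • c i ∈ W) {i : ℕ} (hi : i ∈ s) : c i ∈ W := by
  rw [← Subspace.forall_mem_dualAnnihilator_apply_eq_zero_iff]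
  intro φ hφ
  -- A functional vanishing on `W` turns the curve into a scalar polynomial that vanishes at all t ≠
  -- 0.
  have hp : (∑ j ∈ s, Polynomial.monomial j (φ (c j)) : Polynomial ℂ) = 0 := by
    refine Polynomial.eq_zero_of_infinite_isRoot _
      ((Set.finite_singleton (0 : ℂ)).infinite_compl.mono fun t ht => ?_)
    have := (Submodule.mem_dualAnnihilator φ).1 hφ _ (h t ht)
    simpa [Polynomial.IsRoot.def, Polynomial.eval_finsetSum, mul_comm] using this
  have := congrArg (fun p => Polynomial.coeff p i) hp
  simpa [Polynomial.coeff_monomial, hi] using this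

/-- Replacing a subspace by the sum of its image under a projection and of its intersection with
the kernel does not change the dimension. -/
theorem finrank_map_sup_inf_ker {V : Type*} [AddCommGroup V] [Module ℂ V] [FiniteDimensional ℂ V]
    (π : V →ₗ[ℂ] V) (hπ : ∀ v, π (π v) = π v) (W : Submodule ℂ V) :
    Module.finrank ℂ ↥(W.map π ⊔ W ⊓ LinearMap.ker π) = Module.finrank ℂ W := by
  have hdisj : W.map π ⊓ (W ⊓ LinearMap.ker π) = ⊥ := by
    rw [eq_bot_iff]
    rintro _ ⟨⟨w, -, rfl⟩, -, hk⟩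
    have h : π (π w) = 0 := hk
    rw [hπ] at h
    exact h
  have h1 := Submodule.finrank_sup_add_finrank_inf_eq (W.map π) (W ⊓ LinearMap.ker π)
  have h2 := LinearMap.finrank_range_add_finrank_ker (π.domRestrict W)
  have h3 : LinearMap.range (π.domRestrict W) = W.map π := by
    ext; simp
  have h4 : Module.finrank ℂ (LinearMap.ker (π.domRestrict W)) =
      Module.finrank ℂ ↥(W ⊓ LinearMap.ker π) := by
    have h5 : (LinearMap.ker (π.domRestrict W)).map W.subtype = W ⊓ LinearMap.ker π := by
      ext; simp [and_comm]
    rw [← h5]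
    exact (LinearEquiv.finrank_eq
      (Submodule.equivMapOfInjective _ W.injective_subtype _))
  rw [hdisj, finrank_bot] at h1
  rw [h3, h4] at h2
  omega

/-! ### Graded Lie algebras of nilpotent endomorphisms -/

section Engel

variable {V : Type*} [AddCommGroup V] [Module ℂ V] [FiniteDimensional ℂ V]

/-- Engel's theorem, relative to a subspace `U`. -/
theorem exists_notMem_forall_apply_mem (L : LieSubalgebra ℂ (Module.End ℂ V))
    (hL : ∀ x ∈ L, IsNilpotent x) (U W : Submodule ℂ V) (hW : ∀ x ∈ L, ∀ w ∈ W, x w ∈ W)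
    (hWU : ¬ W ≤ U) : ∃ w ∈ W, w ∉ U ∧ ∀ x ∈ L, x w ∈ U := by
  have hnil : LieModule.IsNilpotent L V := by
    rw [LieModule.isNilpotent_iff_forall (R := ℂ)]
    intro x
    exact hL x x.2
  obtain ⟨k, hk⟩ := (LieModule.isNilpotent_iff ℂ L V).1 hnil
  by_contra! hcon
  -- If every vector of `W` outside `U` can be moved by `L` to another one, every term of the lower
  -- central series has vectors outside `U`.
  have key : ∀ n, ∃ w ∈ W, w ∉ U ∧ w ∈ LieModule.lowerCentralSeries ℂ L V n := by
    intro n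
    induction n with
    | zero =>
      obtain ⟨w, hw, hwU⟩ := Set.not_subset.1 hWU
      exact ⟨w, hw, hwU, by simp⟩
    | succ n ih =>
      obtain ⟨w, hw, hwU, hwn⟩ := ih
      obtain ⟨x, hx, hxw⟩ := hcon w hw hwU
      refine ⟨x w, hW x hx w hw, hxw, ?_⟩
      rw [LieModule.lowerCentralSeries_succ]
      exact LieSubmodule.lie_mem_lie (LieSubmodule.mem_top (⟨x, hx⟩ : L)) hwn
  obtain ⟨w, -, hwU, hwk⟩ := key k
  rw [hk] at hwk
  exact hwU (by rw [(LieSubmodule.mem_bot w).1 hwk]; exact zero_mem U)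

/-- The elements of a Lie algebra of endomorphisms that commute with `P`. -/
def centralizerIn (P : Module.End ℂ V) (L : LieSubalgebra ℂ (Module.End ℂ V)) :
    LieSubalgebra ℂ (Module.End ℂ V) where
  carrier := {x | x ∈ L ∧ Commute P x}
  zero_mem' := ⟨zero_mem L, Commute.zero_right P⟩
  add_mem' := fun hx hy => ⟨add_mem hx.1 hy.1, hx.2.add_right hy.2⟩
  smul_mem' := fun c _ hx => ⟨L.smul_mem c hx.1, hx.2.smul_right c⟩
  lie_mem' := fun hx hy => ⟨L.lie_mem hx.1 hy.1, by
    rw [Ring.lie_def]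
    exact (hx.2.mul_right hy.2).sub_right (hy.2.mul_right hx.2)⟩

variable {P : Module.End ℂ V} {L : LieSubalgebra ℂ (Module.End ℂ V)}

/-- Write L₋₁, L₀, L₁ for the weight parts of `L`. Engel's theorem is available only for L₀; it is
applied modulo `U`, once or twice, to vectors chosen so that L₁ and L₋₁ are then controlled by
weight reasons or by [L₁, L₋₁] ⊆ L₀. -/
theorem exists_homogeneous_forall_apply_mem (hP : IsIdempotentElem P)
    (hup : ∀ x ∈ L, P * x * (1 - P) ∈ L) (hlow : ∀ x ∈ L, (1 - P) * x * P ∈ L)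
    (hmid : ∀ x ∈ L, P * x * P + (1 - P) * x * (1 - P) ∈ L)
    (hnil : ∀ x ∈ L, Commute P x → IsNilpotent x) {U : Submodule ℂ V}
    (hUL : ∀ x ∈ L, ∀ v ∈ U, x v ∈ U) (hU : U ≠ ⊤) :
    ∃ v ∉ U, (P v = v ∨ P v = 0) ∧ ∀ x ∈ L, x v ∈ U := by
  have hPP : ∀ v, P (P v) = P v := fun v => LinearMap.congr_fun hP v
  have hL0 : ∀ x ∈ centralizerIn P L, IsNilpotent x := fun x hx => hnil x hx.1 hx.2
  have hcomm : ∀ x ∈ centralizerIn P L, ∀ v, P (x v) = x (P v) := fun x hx v =>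
    LinearMap.congr_fun hx.2 v
  have hmid' : ∀ x ∈ L, P * x * P + (1 - P) * x * (1 - P) ∈ centralizerIn P L := fun x hx =>
    ⟨hmid x hx, by
      have h1 : P * (1 - P) = 0 := hP.mul_one_sub_self
      have h2 : (1 - P) * P = 0 := hP.one_sub_mul_self
      change P * _ = _ * P
      simp only [mul_add, add_mul, mul_assoc, hP.eq, h2, mul_zero, add_zero]
      simp only [← mul_assoc, hP.eq, h1, zero_mul, add_zero]⟩
  have hdec : ∀ (x : Module.End ℂ V) v, x v = (P * x * (1 - P)) v + ((1 - P) * x * P) v +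
      (P * x * P + (1 - P) * x * (1 - P)) v := fun x v => by
    simp
    abel
  have hcrit : ∀ v, (∀ x ∈ centralizerIn P L, x v ∈ U) →
      (∀ x ∈ L, (P * x * (1 - P)) v ∈ U) → (∀ x ∈ L, ((1 - P) * x * P) v ∈ U) →
      ∀ x ∈ L, x v ∈ U := fun v h0 h1 h2 x hx => by
    rw [hdec]
    exact add_mem (add_mem (h1 x hx) (h2 x hx)) (h0 _ (hmid' x hx))
  by_cases hr : LinearMap.range P ≤ U
  -- The component of `w` in ker P works: L₁ maps it into range P, which is inside `U`, and L₋₁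
  -- kills it.
  · obtain ⟨w, -, hwU, hw⟩ := exists_notMem_forall_apply_mem (centralizerIn P L) hL0 U ⊤
      (fun _ _ _ _ => Submodule.mem_top) (fun h => hU (top_le_iff.1 h))
    have hPw : P w ∈ U := hr ⟨w, rfl⟩
    refine ⟨w - P w, fun h => hwU ((Submodule.sub_mem_iff_left U hPw).1 h),
      Or.inr (by simp [hPP]), hcrit _ ?_ ?_ ?_⟩
    · intro x hx
      rw [map_sub]
      exact sub_mem (hw x hx) (hUL x hx.1 _ hPw)
    · intro x _
      exact hr ⟨_, rfl⟩
    · intro x _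
      simp [hPP]
  · obtain ⟨w, ⟨w, rfl⟩, hwU, hw⟩ := exists_notMem_forall_apply_mem (centralizerIn P L) hL0 U
      (LinearMap.range P) (by rintro x hx _ ⟨v, rfl⟩; exact ⟨x v, hcomm x hx v⟩) hr
    by_cases hlw : ∀ x ∈ L, ((1 - P) * x * P) (P w) ∈ U
    · exact ⟨P w, hwU, Or.inl (hPP w), hcrit _ hw (fun x _ => by simp [hPP]) hlw⟩
    · push Not at hlw
      obtain ⟨x₀, hx₀, hx₀U⟩ := hlw
      -- `W` is L₋₁(Pw) + U. It is stable under L₀, since L₀ sends Pw into `U`, so Engel's theorem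
      -- applies a second time.
      set W : Submodule ℂ V :=
        { carrier := {v | ∃ x ∈ L, ((1 - P) * x * P) (P w) - v ∈ U}
          zero_mem' := ⟨0, zero_mem L, by simp⟩
          add_mem' := by
            rintro v v' ⟨x, hx, hv⟩ ⟨x', hx', hv'⟩
            refine ⟨x + x', add_mem hx hx', ?_⟩
            have := add_mem hv hv'
            rw [mul_add, add_mul, LinearMap.add_apply]
            rwa [sub_add_sub_comm] at this
          smul_mem' := by
            rintro c v ⟨x, hx, hv⟩
            refine ⟨c • x, L.smul_mem c hx, ?_⟩
            have := U.smul_mem c hv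
            rwa [mul_smul_comm, smul_mul_assoc, LinearMap.smul_apply, ← smul_sub] } with hW
      obtain ⟨v, ⟨x, hx, hxv⟩, hvU, hv⟩ := exists_notMem_forall_apply_mem (centralizerIn P L) hL0 U
        W (by
          rintro y hy v ⟨x, hx, hxv⟩
          refine ⟨⁅y, x⁆, L.lie_mem hy.1 hx, ?_⟩
          have h1 : ((1 - P) * ⁅y, x⁆ * P) (P w) =
              y (((1 - P) * x * P) (P w)) - ((1 - P) * x * P) (y (P w)) := by
            simp [Ring.lie_def, hPP, hcomm y hy]
            abel
          rw [h1, sub_right_comm, ← map_sub]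
          exact sub_mem (hUL y hy.1 _ hxv) (hUL _ (hlow x hx) _ (hw y hy)))
        (fun h => hx₀U (h ⟨x₀, hx₀, by simp⟩))
      refine ⟨((1 - P) * x * P) (P w), fun h => hvU ((Submodule.sub_mem_iff_right U h).1 hxv),
        Or.inr (by simp [hPP]), hcrit _ ?_ ?_ ?_⟩
      · intro y hy
        have := add_mem (hUL y hy.1 _ hxv) (hv y hy)
        rwa [map_sub, sub_add_cancel] at this
      · intro z hz
        -- L₁ kills Pw, so on Pw the product of the raising and the lowering part is their bracket,
        -- which has weight 0 and sends Pw into `U`.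
        have h1 : ⁅P * z * (1 - P), (1 - P) * x * P⁆ ∈ centralizerIn P L := by
          refine ⟨L.lie_mem (hup z hz) (hlow x hx), ?_⟩
          ext v
          simp [Ring.lie_def, hPP]
        have h2 := hw _ h1
        simpa [Ring.lie_def, hPP] using h2
      · intro z _
        simp [hPP]

/-- A Lie algebra of endomorphisms that is graded by the adjoint action of a projection `P` and
whose elements of degree zero are nilpotent consists of nilpotent endomorphisms. -/
theorem isNilpotent_of_graded (hP : IsIdempotentElem P)
    (hup : ∀ x ∈ L, P * x * (1 - P) ∈ L) (hlow : ∀ x ∈ L, (1 - P) * x * P ∈ L)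
    (hmid : ∀ x ∈ L, P * x * P + (1 - P) * x * (1 - P) ∈ L)
    (hnil : ∀ x ∈ L, Commute P x → IsNilpotent x) : ∀ x ∈ L, IsNilpotent x := by
  -- Take a maximal stable subspace on which every element is nilpotent; a homogeneous vector sent
  -- into it by `L` would enlarge it.
  obtain ⟨U, ⟨hUP, hUL, hUn⟩, hmax⟩ := (wellFounded_gt (α := Submodule ℂ V)).has_min
    {U | (∀ v ∈ U, P v ∈ U) ∧ (∀ x ∈ L, ∀ v ∈ U, x v ∈ U) ∧
      ∀ x ∈ L, ∃ m : ℕ, ∀ v ∈ U, (x ^ m) v = 0} ⟨⊥, by simp, by simp, by simp⟩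
  suffices hU : U = ⊤ by
    intro x hx
    obtain ⟨m, hm⟩ := hUn x hx
    exact ⟨m, LinearMap.ext fun v => hm v (hU ▸ Submodule.mem_top)⟩
  by_contra hU
  obtain ⟨v, hvU, hPv, hv⟩ :=
    exists_homogeneous_forall_apply_mem hP hup hlow hmid hnil hUL hU
  refine hmax (U ⊔ Submodule.span ℂ {v}) ⟨?_, ?_, ?_⟩ ?_
  · intro y hy
    obtain ⟨u, hu, z, hz, rfl⟩ := Submodule.mem_sup.1 hy
    obtain ⟨c, rfl⟩ := Submodule.mem_span_singleton.1 hz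
    rw [map_add, map_smul]
    refine Submodule.add_mem_sup (hUP u hu) (Submodule.smul_mem _ c ?_)
    rcases hPv with h | h <;> rw [h]
    · exact Submodule.mem_span_singleton_self v
    · exact zero_mem _
  · intro x hx y hy
    obtain ⟨u, hu, z, hz, rfl⟩ := Submodule.mem_sup.1 hy
    obtain ⟨c, rfl⟩ := Submodule.mem_span_singleton.1 hz
    rw [map_add, map_smul]
    exact Submodule.mem_sup_left (add_mem (hUL x hx u hu) (U.smul_mem c (hv x hx)))
  · intro x hx
    obtain ⟨m, hm⟩ := hUn x hx
    refine ⟨m + 1, fun y hy => ?_⟩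
    obtain ⟨u, hu, z, hz, rfl⟩ := Submodule.mem_sup.1 hy
    obtain ⟨c, rfl⟩ := Submodule.mem_span_singleton.1 hz
    rw [pow_succ, Module.End.mul_apply, map_add, map_smul]
    exact hm _ (add_mem (hUL x hx u hu) (U.smul_mem c (hv x hx)))
  · exact left_lt_sup.2 fun h => hvU (h (Submodule.mem_span_singleton_self v))

end Engel

/-! ### The actions on forms -/

section Actions

variable {ι : Type*} [Fintype ι]

theorem lieAct_X (A : Matrix ι ι ℂ) (j : ι) : lieAct A (MvPolynomial.X j) = linForm A j :=
  MvPolynomial.mkDerivation_X ℂ _ j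

theorem subst_X (A : Matrix ι ι ℂ) (j : ι) : subst A (MvPolynomial.X j) = linForm A j :=
  MvPolynomial.aeval_X _ j

theorem subst_linForm (A B : Matrix ι ι ℂ) (j : ι) :
    subst A (linForm B j) = linForm (A * B) j := by
  rw [← subst_X B, ← AlgHom.comp_apply, ← subst_mul, subst_X]

theorem lieAct_zero : lieAct (0 : Matrix ι ι ℂ) = 0 := by
  simpa using lieAct_smul (0 : ℂ) (0 : Matrix ι ι ℂ)

/-- Both sides are derivations along the homomorphism `subst P`, so it suffices to compare them on
variables. For invertible `P` this transports annihilators by conjugation. -/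
theorem subst_lieAct {P A B : Matrix ι ι ℂ} (h : P * A = B * P) (p : MvPolynomial ι ℂ) :
    subst P (lieAct A p) = lieAct B (subst P p) := by
  induction p using MvPolynomial.induction_on with
  | C c => simp [← MvPolynomial.algebraMap_eq]
  | add p q hp hq => simp [hp, hq]
  | mul_X p j hp =>
    simp only [Derivation.leibniz, map_add, smul_eq_mul, map_mul, hp, lieAct_X, subst_X,
      subst_linForm, lieAct_linForm, h]

theorem lieAct_comm [DecidableEq ι] {A B : Matrix ι ι ℂ} (h : Commute A B)
    (p : MvPolynomial ι ℂ) : lieAct A (lieAct B p) = lieAct B (lieAct A p) := by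
  have h1 := lieAct_lie A B
  rw [Ring.lie_def, h.eq, sub_self, lieAct_zero] at h1
  have h2 := congrArg (fun D => D p) h1
  simp only [Derivation.commutator_apply, Derivation.coe_zero, Pi.zero_apply] at h2
  exact (sub_eq_zero.1 h2.symm)

/-- The linear form with the given coefficients. -/
def formOfVec : (ι → ℂ) →ₗ[ℂ] MvPolynomial ι ℂ where
  toFun v := ∑ i, v i • MvPolynomial.X i
  map_add' v w := by simp [add_smul, Finset.sum_add_distrib]
  map_smul' c v := by simp [Finset.smul_sum, mul_smul]

theorem formOfVec_single [DecidableEq ι] (j : ι) :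
    formOfVec (Pi.single j 1) = (MvPolynomial.X j : MvPolynomial ι ℂ) := by
  simp [formOfVec, Pi.single_apply, ite_smul]

theorem lieAct_formOfVec (A : Matrix ι ι ℂ) (v : ι → ℂ) :
    lieAct A (formOfVec v) = formOfVec (A.mulVec v) := by
  simp only [formOfVec, LinearMap.coe_mk, AddHom.coe_mk, map_sum, Derivation.map_smul, lieAct_X,
    linForm, Matrix.mulVec, dotProduct, Finset.sum_smul, Finset.smul_sum]
  rw [Finset.sum_comm]
  refine Finset.sum_congr rfl fun i _ => Finset.sum_congr rfl fun j _ => ?_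
  rw [← MvPolynomial.smul_eq_C_mul, smul_smul, mul_comm]

/-- The orbit map of `gl(X)` at `f`. -/
def lieActAt (f : MvPolynomial ι ℂ) : Matrix ι ι ℂ →ₗ[ℂ] MvPolynomial ι ℂ where
  toFun A := lieAct A f
  map_add' A B := by simp [lieAct_add]
  map_smul' c A := by simp [lieAct_smul]

/-- Rank-nullity for the orbit map; it converts the codimension of orbits into dimensions of
stabilizers. -/
theorem finrank_lieStabilizer_add_orbitDim [DecidableEq ι] (f : MvPolynomial ι ℂ) :
    Module.finrank ℂ (lieStabilizer f).toSubmodule + orbitDim f =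
      Module.finrank ℂ (Matrix ι ι ℂ) := by
  have h1 : (lieStabilizer f).toSubmodule = LinearMap.ker (lieActAt f) := rfl
  have h2 : orbitTangent f = LinearMap.range (lieActAt f) := rfl
  rw [orbitDim, h1, h2, add_comm]
  exact LinearMap.finrank_range_add_finrank_ker (lieActAt f)

/-- Derivations kill constants. This excludes d = 0, where a/d in `ell` would be the default value
0. -/
theorem orbitDim_eq_zero_of_isHomogeneous_zero {f : MvPolynomial ι ℂ} (hf : f.IsHomogeneous 0) :
    orbitDim f = 0 := by
  have h : orbitTangent f = ⊥ := by
    rw [eq_bot_iff]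
    rintro _ ⟨A, rfl⟩
    rw [MvPolynomial.totalDegree_eq_zero_iff_eq_C.1 (Nat.le_zero.1 hf.totalDegree_le),
      ← MvPolynomial.algebraMap_eq, Derivation.map_algebraMap]
    exact zero_mem _
  rw [orbitDim, h, finrank_bot]

/-! ### Jordan decomposition -/

/-- By the Leibniz rule D(pq) = pDq + qDp, and each summand lowers one of the two exponents; induct
on r + s. -/
theorem pow_add_derivation_mul_eq_zero {R : Type*} [CommRing R] [Algebra ℂ R]
    (D : Derivation ℂ R R) {r s : ℕ} {p q : R}
    (hp : ((D : R →ₗ[ℂ] R) ^ r) p = 0) (hq : ((D : R →ₗ[ℂ] R) ^ s) q = 0) :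
    ((D : R →ₗ[ℂ] R) ^ (r + s)) (p * q) = 0 := by
  induction h : r + s generalizing r s p q with
  | zero =>
    obtain rfl : r = 0 := by omega
    have : p = 0 := hp
    simp [this]
  | succ n ih =>
    rcases r with _ | r
    · have : p = 0 := hp
      simp [this]
    rcases s with _ | s
    · have : q = 0 := hq
      simp [this]
    rw [pow_succ, Module.End.mul_apply, Derivation.coeFn_coe, Derivation.leibniz, map_add,
      smul_eq_mul, smul_eq_mul]
    rw [pow_succ, Module.End.mul_apply] at hp hq
    rw [Derivation.coeFn_coe] at hp hq
    rw [ih (r := r + 1) (s := s) (by rwa [pow_succ, Module.End.mul_apply, Derivation.coeFn_coe]) hq (by omega),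
      ih (r := s + 1) (s := r) (by rwa [pow_succ, Module.End.mul_apply, Derivation.coeFn_coe]) hp
        (by omega), add_zero]

/-- The polynomials killed by some power of a derivation form a subalgebra, and here it contains the
variables. The exponent depends on `p`. -/
theorem exists_pow_lieAct_eq_zero [DecidableEq ι] {N : Matrix ι ι ℂ} (hN : IsNilpotent N)
    (p : MvPolynomial ι ℂ) :
    ∃ r : ℕ, ((lieAct N : MvPolynomial ι ℂ →ₗ[ℂ] MvPolynomial ι ℂ) ^ r) p = 0 := by
  induction p using MvPolynomial.induction_on with
  | C c => exact ⟨1, by simp [← MvPolynomial.algebraMap_eq]⟩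
  | add p q hp hq =>
    obtain ⟨r, hr⟩ := hp
    obtain ⟨s, hs⟩ := hq
    refine ⟨r + s, ?_⟩
    rw [map_add, pow_add, Module.End.mul_apply, Module.End.mul_apply, hs, map_zero, add_zero,
      ← Module.End.mul_apply, ← pow_add, add_comm, pow_add, Module.End.mul_apply, hr, map_zero]
  | mul_X p j hp =>
    obtain ⟨r, hr⟩ := hp
    obtain ⟨m, hm⟩ := hN
    have key : ∀ (n : ℕ) (v : ι → ℂ),
        ((lieAct N : MvPolynomial ι ℂ →ₗ[ℂ] MvPolynomial ι ℂ) ^ n) (formOfVec v) =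
          formOfVec ((N ^ n).mulVec v) := by
      intro n
      induction n with
      | zero => simp
      | succ n ih =>
        intro v
        rw [pow_succ, Module.End.mul_apply, Derivation.coeFn_coe, lieAct_formOfVec, ih,
          Matrix.mulVec_mulVec, ← pow_succ]
    exact ⟨r + m, pow_add_derivation_mul_eq_zero _ hr (by
      rw [← formOfVec_single, key, hm, Matrix.zero_mulVec, map_zero])⟩

/-- Under a derivation, eigenvectors multiply to eigenvectors with eigenvalues adding. So the sum of
the eigenspaces is a subalgebra, and it contains the linear forms because `S` is diagonalizable over
ℂ. -/
theorem iSup_eigenspace_lieAct_eq_top [DecidableEq ι] {S : Matrix ι ι ℂ}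
    (hS : Module.End.IsSemisimple (Matrix.toLin' S)) :
    ⨆ μ, Module.End.eigenspace (lieAct S : MvPolynomial ι ℂ →ₗ[ℂ] MvPolynomial ι ℂ) μ = ⊤ := by
  set T := ⨆ μ, Module.End.eigenspace (lieAct S : MvPolynomial ι ℂ →ₗ[ℂ] MvPolynomial ι ℂ) μ
    with hT
  have hle : ∀ μ {p : MvPolynomial ι ℂ}, lieAct S p = μ • p → p ∈ T := fun μ p hp =>
    (le_iSup (fun μ => Module.End.eigenspace
      (lieAct S : MvPolynomial ι ℂ →ₗ[ℂ] MvPolynomial ι ℂ) μ) μ)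
      (Module.End.mem_eigenspace_iff.2 hp)
  have hind : ∀ (C : MvPolynomial ι ℂ → Prop) {p : MvPolynomial ι ℂ}, p ∈ T → C 0 →
      (∀ p q, C p → C q → C (p + q)) → (∀ μ p, lieAct S p = μ • p → C p) → C p :=
    fun C p hp h0 hadd h => Submodule.iSup_induction _ (motive := C) hp
      (fun μ p hp => h μ p (Module.End.mem_eigenspace_iff.1 hp)) h0 hadd
  have hmul : ∀ p ∈ T, ∀ q ∈ T, p * q ∈ T := by
    intro p hp q hq
    refine hind (fun p => p * q ∈ T) hp (by simp) (fun p p' h h' => by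
      rw [add_mul]; exact add_mem h h') ?_
    intro μ p hp
    refine hind (fun q => p * q ∈ T) hq (by simp) (fun q q' h h' => by
      rw [mul_add]; exact add_mem h h') ?_
    intro ν q hq
    refine hle (μ + ν) ?_
    rw [Derivation.leibniz, hp, hq, smul_eq_mul, smul_eq_mul, mul_smul_comm, mul_smul_comm,
      mul_comm q p, add_smul, add_comm]
  have hlin : ∀ v, formOfVec v ∈ T := by
    intro v
    have h1 := hS.isFinitelySemisimple.iSup_maxGenEigenspace_eq_top_iff.1
      (Module.End.iSup_maxGenEigenspace_eq_top (Matrix.toLin' S))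
    have hv : v ∈ ⨆ μ, Module.End.eigenspace (Matrix.toLin' S) μ := h1 ▸ Submodule.mem_top
    refine Submodule.iSup_induction _ (motive := fun v => formOfVec v ∈ T) hv (fun μ v hv => hle μ ?_) (by simp)
      (fun v w h h' => by rw [map_add]; exact add_mem h h')
    rw [lieAct_formOfVec, ← map_smul, ← Module.End.mem_eigenspace_iff.1 hv, Matrix.toLin'_apply]
  rw [eq_top_iff]
  rintro p -
  induction p using MvPolynomial.induction_on with
  | C c => exact hle 0 (by simp [← MvPolynomial.algebraMap_eq])
  | add p q hp hq => exact add_mem hp hq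
  | mul_X p j hp => exact hmul p hp _ (formOfVec_single (ι := ι) j ▸ hlin _)

/-- Split `v` into eigenvectors. By independence μ ^ r kills each component, so only μ = 0
contributes. -/
theorem apply_eq_zero_of_pow_apply_eq_zero {M : Type*} [AddCommGroup M] [Module ℂ M]
    {T : Module.End ℂ M} (hT : ⨆ μ, T.eigenspace μ = ⊤) {r : ℕ} {v : M} (hv : (T ^ r) v = 0) :
    T v = 0 := by
  obtain ⟨c, hc, rfl⟩ := (Submodule.mem_iSup_iff_exists_finsupp (fun μ => T.eigenspace μ) v).1
    (hT ▸ Submodule.mem_top)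
  have hTc : ∀ μ, T (c μ) = μ • c μ := fun μ => Module.End.mem_eigenspace_iff.1 (hc μ)
  have hpow : ∀ (n : ℕ) μ, (T ^ n) (c μ) = μ ^ n • c μ := by
    intro n μ
    induction n with
    | zero => simp
    | succ n ih => rw [pow_succ', Module.End.mul_apply, ih, map_smul, hTc, smul_smul, pow_succ]
  have h0 := (iSupIndep_iff_finsetSum_eq_zero_imp_eq_zero _).1
    (Module.End.eigenspaces_iSupIndep T) c.support (fun μ => μ ^ r • c μ)
    (fun μ _ => Submodule.smul_mem _ _ (hc μ)) (by
      simpa [Finsupp.sum, hpow] using hv)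
  rw [Finsupp.sum, map_sum]
  refine Finset.sum_eq_zero fun μ hμ => ?_
  rw [hTc]
  rcases smul_eq_zero.1 (h0 μ hμ) with h | h
  · rw [IsReduced.eq_zero μ ⟨r, h⟩, zero_smul]
  · rw [h, smul_zero]

/-- The semisimple part of an annihilator of `f` annihilates `f`. -/
theorem lieAct_eq_zero_of_semisimple_add_nilpotent [DecidableEq ι] {S N : Matrix ι ι ℂ}
    (hS : Module.End.IsSemisimple (Matrix.toLin' S)) (hN : IsNilpotent N) (hSN : Commute S N)
    {f : MvPolynomial ι ℂ} (hf : lieAct (N + S) f = 0) : lieAct S f = 0 := by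
  set s : Module.End ℂ (MvPolynomial ι ℂ) := (lieAct S : MvPolynomial ι ℂ →ₗ[ℂ] MvPolynomial ι ℂ)
  set n : Module.End ℂ (MvPolynomial ι ℂ) := (lieAct N : MvPolynomial ι ℂ →ₗ[ℂ] MvPolynomial ι ℂ)
  have hcomm : Commute s n := LinearMap.ext fun p => lieAct_comm hSN p
  obtain ⟨r, hr⟩ := exists_pow_lieAct_eq_zero hN f
  have hr' : (n ^ r) f = 0 := hr
  have hsn : s f = -n f := by
    rw [lieAct_add, Derivation.add_apply] at hf
    exact eq_neg_of_add_eq_zero_right hf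
  refine apply_eq_zero_of_pow_apply_eq_zero (T := s) (iSup_eigenspace_lieAct_eq_top hS)
    (r := r) ?_
  -- Since s f = -n f and s commutes with n, local nilpotency of n at `f` passes to s, which is
  -- diagonalizable.
  have key : ∀ m : ℕ, (s ^ m) f = (-1 : ℂ) ^ m • (n ^ m) f := by
    intro m
    induction m with
    | zero => simp
    | succ m ih =>
      rw [pow_succ', Module.End.mul_apply, ih, map_smul, ← Module.End.mul_apply,
        (hcomm.pow_right m).eq, Module.End.mul_apply, hsn, map_neg, pow_succ n,
        Module.End.mul_apply, pow_succ, mul_smul, neg_one_smul]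
  rw [key, hr', smul_zero]

end Actions

/-! ### The grading of `gl(X)` by the weights of `λ` -/

section Grading

variable {ι : Type*} [DecidableEq ι]

/-- The projection onto the span of the variables in `Z`. -/
def blockProj (Z : Finset ι) : Matrix ι ι ℂ :=
  Matrix.diagonal fun i => if i ∈ Z then 1 else 0

/-- The component of weight `1` of a matrix. -/
def upPart (Z : Finset ι) : Matrix ι ι ℂ →ₗ[ℂ] Matrix ι ι ℂ where
  toFun M := Matrix.of fun i j => if i ∈ Z ∧ j ∉ Z then M i j else 0
  map_add' M N := by ext i j; simp only [Matrix.of_apply, Matrix.add_apply]; split_ifs <;> simp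
  map_smul' c M := by ext i j; simp

/-- The component of weight `0` of a matrix. -/
def midPart (Z : Finset ι) : Matrix ι ι ℂ →ₗ[ℂ] Matrix ι ι ℂ where
  toFun M := Matrix.of fun i j => if i ∈ Z ↔ j ∈ Z then M i j else 0
  map_add' M N := by ext i j; simp only [Matrix.of_apply, Matrix.add_apply]; split_ifs <;> simp
  map_smul' c M := by ext i j; simp

/-- The component of weight `-1` of a matrix. -/
def lowPart (Z : Finset ι) : Matrix ι ι ℂ →ₗ[ℂ] Matrix ι ι ℂ where
  toFun M := Matrix.of fun i j => if i ∉ Z ∧ j ∈ Z then M i j else 0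
  map_add' M N := by ext i j; simp only [Matrix.of_apply, Matrix.add_apply]; split_ifs <;> simp
  map_smul' c M := by ext i j; simp

variable (Z : Finset ι) (M : Matrix ι ι ℂ)

theorem upPart_apply (i j : ι) : upPart Z M i j = if i ∈ Z ∧ j ∉ Z then M i j else 0 := rfl

theorem midPart_apply (i j : ι) : midPart Z M i j = if i ∈ Z ↔ j ∈ Z then M i j else 0 := rfl

theorem lowPart_apply (i j : ι) : lowPart Z M i j = if i ∉ Z ∧ j ∈ Z then M i j else 0 := rfl

theorem lowPart_add_midPart_add_upPart : lowPart Z M + midPart Z M + upPart Z M = M := by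
  ext i j
  simp only [Matrix.add_apply, upPart_apply, midPart_apply, lowPart_apply]
  by_cases hi : i ∈ Z <;> by_cases hj : j ∈ Z <;> simp [hi, hj]

theorem upPart_upPart : upPart Z (upPart Z M) = upPart Z M := by
  ext i j; simp only [upPart_apply]; split_ifs <;> rfl

theorem midPart_midPart : midPart Z (midPart Z M) = midPart Z M := by
  ext i j; simp only [midPart_apply]; split_ifs <;> rfl

theorem lowPart_lowPart : lowPart Z (lowPart Z M) = lowPart Z M := by
  ext i j; simp only [lowPart_apply]; split_ifs <;> rfl

theorem upPart_midPart : upPart Z (midPart Z M) = 0 := by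
  ext i j; simp only [upPart_apply, midPart_apply, Matrix.zero_apply]
  split_ifs <;> first | rfl | tauto

theorem upPart_lowPart : upPart Z (lowPart Z M) = 0 := by
  ext i j; simp only [upPart_apply, lowPart_apply, Matrix.zero_apply]
  split_ifs <;> first | rfl | tauto

theorem midPart_upPart : midPart Z (upPart Z M) = 0 := by
  ext i j; simp only [upPart_apply, midPart_apply, Matrix.zero_apply]
  split_ifs <;> first | rfl | tauto

theorem midPart_lowPart : midPart Z (lowPart Z M) = 0 := by
  ext i j; simp only [lowPart_apply, midPart_apply, Matrix.zero_apply]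
  split_ifs <;> first | rfl | tauto

theorem lowPart_upPart : lowPart Z (upPart Z M) = 0 := by
  ext i j; simp only [upPart_apply, lowPart_apply, Matrix.zero_apply]
  split_ifs <;> first | rfl | tauto

theorem lowPart_midPart : lowPart Z (midPart Z M) = 0 := by
  ext i j; simp only [lowPart_apply, midPart_apply, Matrix.zero_apply]
  split_ifs <;> first | rfl | tauto

theorem twoBlock_eq (t : ℂ) : twoBlock Z t = 1 + (t - 1) • blockProj Z := by
  rw [twoBlock, blockProj, ← Matrix.diagonal_one, ← Matrix.diagonal_smul, Matrix.diagonal_add]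
  congr 1; ext i; by_cases hi : i ∈ Z <;> simp [hi]

theorem ell_eq (a d : ℕ) :
    ell Z a d = blockProj Z - ((a : ℂ) / d) • (1 : Matrix ι ι ℂ) := by
  rw [ell, blockProj, ← Matrix.diagonal_one, ← Matrix.diagonal_smul, Matrix.diagonal_sub]
  congr 1; ext i; simp

variable [Fintype ι]

theorem isIdempotentElem_blockProj : IsIdempotentElem (blockProj Z) := by
  rw [IsIdempotentElem, blockProj, Matrix.diagonal_mul_diagonal]
  congr 1; ext i; split_ifs <;> simp

theorem upPart_eq : upPart Z M = blockProj Z * M * (1 - blockProj Z) := by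
  ext i j
  simp only [upPart_apply, blockProj, mul_sub, mul_one, Matrix.sub_apply, Matrix.diagonal_mul,
    Matrix.mul_diagonal]
  by_cases hi : i ∈ Z <;> by_cases hj : j ∈ Z <;> simp [hi, hj]

theorem lowPart_eq : lowPart Z M = (1 - blockProj Z) * M * blockProj Z := by
  ext i j
  simp only [lowPart_apply, blockProj, sub_mul, one_mul, Matrix.sub_apply, Matrix.diagonal_mul,
    Matrix.mul_diagonal]
  by_cases hi : i ∈ Z <;> by_cases hj : j ∈ Z <;> simp [hi, hj]

theorem midPart_eq : midPart Z M =
    blockProj Z * M * blockProj Z + (1 - blockProj Z) * M * (1 - blockProj Z) := by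
  ext i j
  simp only [midPart_apply, blockProj, sub_mul, one_mul, mul_sub, mul_one, Matrix.sub_apply,
    Matrix.add_apply, Matrix.diagonal_mul, Matrix.mul_diagonal]
  by_cases hi : i ∈ Z <;> by_cases hj : j ∈ Z <;> simp [hi, hj]

theorem blockProj_mul_upPart : blockProj Z * upPart Z M = upPart Z M := by
  rw [upPart_eq, ← mul_assoc, ← mul_assoc, (isIdempotentElem_blockProj Z).eq]

theorem upPart_mul_blockProj : upPart Z M * blockProj Z = 0 := by
  rw [upPart_eq, mul_assoc, (isIdempotentElem_blockProj Z).one_sub_mul_self, mul_zero]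

theorem lie_blockProj : ⁅blockProj Z, M⁆ = upPart Z M - lowPart Z M := by
  rw [Ring.lie_def, upPart_eq, lowPart_eq]
  noncomm_ring

variable {Z M}

theorem midPart_eq_self (h : Commute (blockProj Z) M) : midPart Z M = M := by
  have hE := isIdempotentElem_blockProj Z
  have h1 : upPart Z M = 0 := by
    rw [upPart_eq, h.eq, mul_assoc, hE.mul_one_sub_self, mul_zero]
  have h2 : lowPart Z M = 0 := by
    rw [lowPart_eq, mul_assoc, ← h.eq, ← mul_assoc, hE.one_sub_mul_self, zero_mul]
  simpa [h1, h2] using lowPart_add_midPart_add_upPart Z M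

theorem isNilpotent_of_isNilpotent_add_upPart {x n : Matrix ι ι ℂ} (hx : Commute (blockProj Z) x)
    (h : IsNilpotent (x + upPart Z n)) : IsNilpotent x := by
  -- Powers change only by a weight 1 term `N`; if the power vanishes, x ^ r = -N has weight 0 and
  -- weight 1 at once.
  have key : ∀ r : ℕ, ∃ N, blockProj Z * N = N ∧ N * blockProj Z = 0 ∧
      (x + upPart Z n) ^ r = x ^ r + N := by
    intro r
    induction r with
    | zero => exact ⟨0, by simp⟩
    | succ r ih =>
      obtain ⟨N, hN1, hN2, hN⟩ := ih
      refine ⟨x ^ r * upPart Z n + N * x, ?_, ?_, ?_⟩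
      · rw [mul_add, ← mul_assoc, (hx.pow_right r).eq, mul_assoc, blockProj_mul_upPart,
          ← mul_assoc, hN1]
      · rw [add_mul, mul_assoc, upPart_mul_blockProj, mul_assoc, ← hx.eq, ← mul_assoc, hN2]
        simp
      · have h0 : N * upPart Z n = 0 := by
          rw [← blockProj_mul_upPart, ← mul_assoc, hN2, zero_mul]
        rw [pow_succ, hN, pow_succ, add_mul, mul_add, mul_add, h0]
        abel
  obtain ⟨r, hr⟩ := h
  obtain ⟨N, hN1, hN2, hN⟩ := key r
  rw [hr] at hN
  have hxN : x ^ r = -N := eq_neg_of_add_eq_zero_left hN.symm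
  refine ⟨r, ?_⟩
  have h1 := (hx.pow_right r).eq
  rw [hxN, mul_neg, neg_mul, hN1, hN2] at h1
  rw [hxN, h1, neg_zero]

theorem twoBlock_mul_inv (Z : Finset ι) {t : ℂ} (ht : t ≠ 0) :
    twoBlock Z t * twoBlock Z t⁻¹ = 1 := by
  rw [twoBlock, twoBlock, Matrix.diagonal_mul_diagonal, ← Matrix.diagonal_one]
  congr 1; ext i; split_ifs <;> simp [ht]

theorem twoBlock_inv_mul (Z : Finset ι) {t : ℂ} (ht : t ≠ 0) :
    twoBlock Z t⁻¹ * twoBlock Z t = 1 := by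
  simpa using twoBlock_mul_inv Z (inv_ne_zero ht)

/-! ### The limit stabilizer as a graded subspace -/

theorem mem_lieStabilizer_twoBlock_iff {t : ℂ} (ht : t ≠ 0) (A : Matrix ι ι ℂ)
    (f : MvPolynomial ι ℂ) : A ∈ lieStabilizer (subst (twoBlock Z t) f) ↔
      twoBlock Z t⁻¹ * A * twoBlock Z t ∈ lieStabilizer f := by
  have h : subst (twoBlock Z t) (lieAct (twoBlock Z t⁻¹ * A * twoBlock Z t) f) =
      lieAct A (subst (twoBlock Z t) f) :=
    subst_lieAct (by rw [← mul_assoc, ← mul_assoc, twoBlock_mul_inv Z ht, one_mul]) f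
  have hinj : Function.Injective (subst (twoBlock Z t)) := by
    refine Function.LeftInverse.injective (g := subst (twoBlock Z t⁻¹)) fun p => ?_
    rw [← AlgHom.comp_apply, ← subst_mul, twoBlock_inv_mul Z ht, subst_one, AlgHom.id_apply]
  change lieAct A (subst (twoBlock Z t) f) = 0 ↔ lieAct _ f = 0
  rw [← h, map_eq_zero_iff _ hinj]

theorem coeff_mem_of_forall_specialize_mem {κ : Type*} [Fintype κ] (W : Submodule ℂ (Matrix κ κ ℂ))
    (B : Matrix κ κ (Polynomial ℂ)) (h : ∀ t : ℂ, t ≠ 0 → specialize B t ∈ W) (n : ℕ) :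
    B.map (fun p => p.coeff n) ∈ W := by
  set N := (Finset.univ.sup fun i => Finset.univ.sup fun j => (B i j).natDegree) + n + 1 with hN
  refine coeff_mem_of_forall_sum_pow_smul_mem W (Finset.range N)
    (fun n => B.map (fun p => p.coeff n)) (fun t ht => ?_) (Finset.mem_range.2 (by omega))
  convert h t ht using 1
  ext i j
  have hij : (B i j).natDegree < N := by
    have h1 : (B i j).natDegree ≤ Finset.univ.sup fun j => (B i j).natDegree :=
      Finset.le_sup (f := fun j => (B i j).natDegree) (Finset.mem_univ j)
    have h2 := Finset.le_sup (f := fun i => Finset.univ.sup fun j => (B i j).natDegree)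
      (Finset.mem_univ i)
    have h3 := h1.trans h2
    omega
  rw [Matrix.sum_apply, specialize, Matrix.map_apply, Polynomial.eval_eq_sum_range' hij]
  refine Finset.sum_congr rfl fun k _ => ?_
  simp [mul_comm]

/-- A(t) ∈ 𝒦(t) means that t⁻¹up + mid + t·low of A(t) lies in 𝒦. Multiplied by t, this is a
polynomial curve in the subspace 𝒦, and its coefficients of order 0, 1, 2 are the three conditions.
-/
theorem mem_limitStabilizer_iff (Z : Finset ι) (f : MvPolynomial ι ℂ) (k : Matrix ι ι ℂ) :
    k ∈ limitStabilizer Z f ↔ upPart Z k ∈ lieStabilizer f ∧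
      (∃ n, midPart Z k + upPart Z n ∈ lieStabilizer f) ∧
      ∃ m, lowPart Z k + midPart Z m + upPart Z m ∈ lieStabilizer f := by
  constructor
  · rintro ⟨A, hA, rfl⟩
    -- The exponent is 1 - w on weight w: the conjugation by λ(t)⁻¹ and the extra factor t.
    set B : Matrix ι ι (Polynomial ℂ) := Matrix.of fun i j =>
      Polynomial.X ^ (if i ∈ Z ∧ j ∉ Z then 0 else if i ∉ Z ∧ j ∈ Z then 2 else 1) * A i j with hB
    have hspec : ∀ t : ℂ, t ≠ 0 → specialize B t ∈ (lieStabilizer f).toSubmodule := by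
      intro t ht
      have h1 := (lieStabilizer f).smul_mem t ((mem_lieStabilizer_twoBlock_iff ht _ f).1 (hA t ht))
      change _ ∈ lieStabilizer f
      convert h1 using 1
      ext i j
      simp only [specialize, hB, Matrix.map_apply, Matrix.of_apply, twoBlock, Matrix.smul_apply,
        Matrix.diagonal_mul, Matrix.mul_diagonal, smul_eq_mul]
      by_cases hi : i ∈ Z <;> by_cases hj : j ∈ Z <;> simp [hi, hj, ht] <;> field_simp
    have hcoeff : ∀ n, (B.map fun p => p.coeff n) ∈ lieStabilizer f :=
      coeff_mem_of_forall_specialize_mem _ B hspec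
    refine ⟨?_, ⟨A.map fun p => p.coeff 1, ?_⟩, ⟨Matrix.of fun i j =>
      if i ∈ Z ∧ j ∉ Z then (A i j).coeff 2 else (A i j).coeff 1, ?_⟩⟩
    · convert hcoeff 0 using 1
      ext i j
      simp only [upPart_apply, hB, Matrix.map_apply, Matrix.of_apply, specialize,
        Polynomial.coeff_X_pow_mul', ← Polynomial.coeff_zero_eq_eval_zero]
      by_cases hi : i ∈ Z <;> by_cases hj : j ∈ Z <;> simp [hi, hj]
    · convert hcoeff 1 using 1
      ext i j
      simp only [upPart_apply, midPart_apply, hB, Matrix.map_apply, Matrix.of_apply, specialize,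
        Matrix.add_apply, Polynomial.coeff_X_pow_mul', ← Polynomial.coeff_zero_eq_eval_zero]
      by_cases hi : i ∈ Z <;> by_cases hj : j ∈ Z <;> simp [hi, hj]
    · convert hcoeff 2 using 1
      ext i j
      simp only [upPart_apply, midPart_apply, lowPart_apply, hB, Matrix.map_apply, Matrix.of_apply,
        specialize, Matrix.add_apply, Polynomial.coeff_X_pow_mul',
        ← Polynomial.coeff_zero_eq_eval_zero]
      by_cases hi : i ∈ Z <;> by_cases hj : j ∈ Z <;> simp [hi, hj]
  · rintro ⟨h1, ⟨n, h2⟩, m, h3⟩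
    -- Chosen so that conjugation by λ(t)⁻¹ gives t⁻¹ times the first given element of 𝒦, plus the
    -- second, plus t times the third.
    refine ⟨Matrix.of fun i j => Polynomial.C (k i j) +
      Polynomial.X * Polynomial.C (upPart Z n i j + midPart Z m i j) +
      Polynomial.X ^ 2 * Polynomial.C (upPart Z m i j), fun t ht => ?_, ?_⟩
    · rw [mem_lieStabilizer_twoBlock_iff ht]
      convert add_mem (add_mem ((lieStabilizer f).smul_mem t⁻¹ h1) h2)
        ((lieStabilizer f).smul_mem t h3) using 1
      ext i j
      simp only [specialize, Matrix.map_apply, Matrix.of_apply, twoBlock, Matrix.smul_apply,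
        Matrix.diagonal_mul, Matrix.mul_diagonal, smul_eq_mul, Matrix.add_apply, upPart_apply,
        midPart_apply, lowPart_apply]
      by_cases hi : i ∈ Z <;> by_cases hj : j ∈ Z <;> simp [hi, hj] <;> field_simp
    · ext i j
      simp [specialize]

/-- The criterion imposes a separate condition on each weight component of `k`, so 𝒦₀ is graded;
likewise for the next two. -/
theorem upPart_mem_limitStabilizer {f : MvPolynomial ι ℂ} {k : Matrix ι ι ℂ}
    (hk : k ∈ limitStabilizer Z f) : upPart Z k ∈ limitStabilizer Z f := by
  rw [mem_limitStabilizer_iff] at hk ⊢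
  rw [upPart_upPart, midPart_upPart, lowPart_upPart]
  exact ⟨hk.1, ⟨0, by simp⟩, 0, by simp⟩

theorem midPart_mem_limitStabilizer {f : MvPolynomial ι ℂ} {k : Matrix ι ι ℂ}
    (hk : k ∈ limitStabilizer Z f) : midPart Z k ∈ limitStabilizer Z f := by
  rw [mem_limitStabilizer_iff] at hk ⊢
  rw [upPart_midPart, midPart_midPart, lowPart_midPart]
  exact ⟨zero_mem _, hk.2.1, 0, by simp⟩

theorem lowPart_mem_limitStabilizer {f : MvPolynomial ι ℂ} {k : Matrix ι ι ℂ}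
    (hk : k ∈ limitStabilizer Z f) : lowPart Z k ∈ limitStabilizer Z f := by
  rw [mem_limitStabilizer_iff] at hk ⊢
  rw [upPart_lowPart, midPart_lowPart, lowPart_lowPart]
  exact ⟨zero_mem _, ⟨0, by simp⟩, hk.2.2⟩

/-- Filter 𝒦 by lowest weight. The leading components low(𝒦), mid(𝒦 ∩ ker low) and 𝒦 ∩ ker low ∩ ker
mid have total dimension dim 𝒦, and all lie in 𝒦₀. -/
theorem finrank_lieStabilizer_le_finrank_limitStabilizer (Z : Finset ι) (f : MvPolynomial ι ℂ) :
    Module.finrank ℂ (lieStabilizer f).toSubmodule ≤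
      Module.finrank ℂ (limitStabilizer Z f).toSubmodule := by
  set K := (lieStabilizer f).toSubmodule
  have h1 := finrank_map_sup_inf_ker (lowPart Z) (lowPart_lowPart Z) K
  have h2 := finrank_map_sup_inf_ker (midPart Z) (midPart_midPart Z)
    (K.map (lowPart Z) ⊔ K ⊓ LinearMap.ker (lowPart Z))
  rw [← h1, ← h2]
  refine Submodule.finrank_mono (sup_le ?_ ?_)
  · rintro _ ⟨w, hw, rfl⟩
    obtain ⟨_, ⟨k, hk, rfl⟩, q, ⟨hq, hq0⟩, rfl⟩ := Submodule.mem_sup.1 hw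
    rw [map_add, midPart_lowPart, zero_add]
    refine (mem_limitStabilizer_iff Z f _).2 ?_
    rw [upPart_midPart, midPart_midPart, lowPart_midPart]
    refine ⟨zero_mem _, ⟨q, ?_⟩, 0, by simp⟩
    have h := lowPart_add_midPart_add_upPart Z q
    rw [LinearMap.mem_ker.1 hq0, zero_add] at h
    rw [h]; exact hq
  · rintro w ⟨hw, hw0⟩
    obtain ⟨_, ⟨k, hk, rfl⟩, q, ⟨hq, hq0⟩, rfl⟩ := Submodule.mem_sup.1 hw
    replace hw0 := LinearMap.mem_ker.1 hw0
    refine (mem_limitStabilizer_iff Z f _).2 ⟨?_, ⟨0, by simp [hw0]⟩, k, ?_⟩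
    · rw [map_add, midPart_lowPart, zero_add] at hw0
      have h := lowPart_add_midPart_add_upPart Z q
      rw [LinearMap.mem_ker.1 hq0, hw0, zero_add, zero_add] at h
      rw [map_add, upPart_lowPart, zero_add, h]
      exact hq
    · rw [map_add, lowPart_lowPart, LinearMap.mem_ker.1 hq0, add_zero,
        lowPart_add_midPart_add_upPart]
      exact hk

end Grading

/-! ### Limits under `λ` -/

section Limits

variable {ι : Type*} [Fintype ι] [DecidableEq ι]

theorem subst_diagonal_monomial (v : ι → ℂ) (m : ι →₀ ℕ) (c : ℂ) :
    subst (Matrix.diagonal v) (MvPolynomial.monomial m c) =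
      MvPolynomial.monomial m ((∏ i, v i ^ m i) * c) := by
  have h : ∀ j, linForm (Matrix.diagonal v) j = MvPolynomial.C (v j) * MvPolynomial.X j := by
    intro j
    simp [linForm, Matrix.diagonal_apply, apply_ite MvPolynomial.C, ite_mul]
  rw [subst, MvPolynomial.aeval_monomial, Finsupp.prod_fintype _ _ (by simp)]
  simp only [h, mul_pow, Finset.prod_mul_distrib, MvPolynomial.algebraMap_eq]
  rw [MvPolynomial.monomial_eq, Finsupp.prod_fintype _ _ (by simp)]
  simp only [map_mul, map_prod, map_pow]
  ring

theorem coeff_subst_diagonal (v : ι → ℂ) (p : MvPolynomial ι ℂ) (m : ι →₀ ℕ) :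
    (subst (Matrix.diagonal v) p).coeff m = (∏ i, v i ^ m i) * p.coeff m := by
  induction p using MvPolynomial.induction_on' with
  | monomial n c =>
    rw [subst_diagonal_monomial, MvPolynomial.coeff_monomial, MvPolynomial.coeff_monomial]
    split_ifs with h
    · rw [h]
    · rw [mul_zero]
  | add p q hp hq => rw [map_add, MvPolynomial.coeff_add, hp, hq, MvPolynomial.coeff_add, mul_add]

theorem lieAct_diagonal_monomial (w : ι → ℂ) (m : ι →₀ ℕ) (c : ℂ) :
    lieAct (Matrix.diagonal w) (MvPolynomial.monomial m c) =
      MvPolynomial.monomial m ((∑ i, w i * m i) * c) := by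
  have h : ∀ j, linForm (Matrix.diagonal w) j = MvPolynomial.C (w j) * MvPolynomial.X j := by
    intro j
    simp [linForm, Matrix.diagonal_apply, apply_ite MvPolynomial.C, ite_mul]
  rw [lieAct, MvPolynomial.mkDerivation_monomial, Finsupp.sum_fintype _ _ (by simp),
    Finset.smul_sum, Finset.sum_mul, map_sum]
  refine Finset.sum_congr rfl fun i _ => ?_
  rw [h, smul_eq_mul]
  rcases Nat.eq_zero_or_pos (m i) with hi | hi
  · simp [hi]
  · have hm : m - Finsupp.single i 1 + Finsupp.single i 1 = m :=
      tsub_add_cancel_of_le (Finsupp.single_le_iff.2 hi)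
    rw [mul_left_comm, MvPolynomial.X, MvPolynomial.monomial_mul, hm, mul_one,
      MvPolynomial.C_mul_monomial, MvPolynomial.smul_monomial, smul_eq_mul]
    congr 1
    ring

theorem coeff_lieAct_diagonal (w : ι → ℂ) (p : MvPolynomial ι ℂ) (m : ι →₀ ℕ) :
    (lieAct (Matrix.diagonal w) p).coeff m = (∑ i, w i * m i) * p.coeff m := by
  induction p using MvPolynomial.induction_on' with
  | monomial n c =>
    rw [lieAct_diagonal_monomial, MvPolynomial.coeff_monomial, MvPolynomial.coeff_monomial]
    split_ifs with h
    · rw [h]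
    · rw [mul_zero]
  | add p q hp hq => rw [map_add, MvPolynomial.coeff_add, hp, hq, MvPolynomial.coeff_add, mul_add]

/-- The coefficients of the leading term of `f` are those of weight `a` of `f`. -/
theorem coeff_eq_of_isLimit {Z : Finset ι} {a : ℕ} {f g : MvPolynomial ι ℂ} (h : IsLimit Z a f g)
    (m : ι →₀ ℕ) : g.coeff m = if ∑ i ∈ Z, m i = a then f.coeff m else 0 := by
  obtain ⟨-, D, c, hc⟩ := h
  set z := ∑ i ∈ Z, m i with hz
  -- The coefficient of the monomial m in λ(t)f is t ^ z times that in f; compare coefficients of t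
  -- ^ a.
  have hp : (Polynomial.monomial a (g.coeff m) + ∑ i ∈ Finset.Ioc a D,
      Polynomial.monomial i ((c i).coeff m) - Polynomial.monomial z (f.coeff m) : Polynomial ℂ) =
        0 := by
    refine Polynomial.eq_zero_of_infinite_isRoot _
      ((Set.finite_singleton (0 : ℂ)).infinite_compl.mono fun t ht => ?_)
    have h1 := congrArg (MvPolynomial.coeff m) (hc t ht)
    rw [twoBlock, coeff_subst_diagonal] at h1
    have h2 : ∏ i, (if i ∈ Z then t else 1) ^ m i = t ^ z := by
      rw [hz, ← Finset.prod_pow_eq_pow_sum]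
      simp [ite_pow, Finset.prod_ite_mem]
    rw [h2, MvPolynomial.coeff_add, MvPolynomial.coeff_smul, MvPolynomial.coeff_sum] at h1
    refine (?_ : Polynomial.IsRoot _ t)
    simp only [Polynomial.IsRoot.def, Polynomial.eval_sub, Polynomial.eval_add,
      Polynomial.eval_monomial, Polynomial.eval_finsetSum]
    simp only [MvPolynomial.coeff_smul, smul_eq_mul] at h1
    simp only [mul_comm _ (t ^ (_ : ℕ))]
    rw [h1, sub_self]
  have h3 := congrArg (fun p => Polynomial.coeff p a) hp
  simp only [Polynomial.coeff_sub, Polynomial.coeff_add, Polynomial.coeff_monomial,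
    Polynomial.finsetSum_coeff, Polynomial.coeff_zero, if_true] at h3
  rw [Finset.sum_eq_zero fun i hi => if_neg (Finset.mem_Ioc.1 hi).1.ne', add_zero] at h3
  exact sub_eq_zero.1 h3

/-- The shift a/d, summed over the d factors of a monomial, is a. So `ell` multiplies a monomial of
degree z in Z by z - a, and its kernel on forms of degree d is the weight a part. -/
theorem sum_ell_mul {Z : Finset ι} {a d : ℕ} (hd : d ≠ 0) {f : MvPolynomial ι ℂ}
    (hf : f.IsHomogeneous d) {m : ι →₀ ℕ} (hm : f.coeff m ≠ 0) :
    ∑ i, ((if i ∈ Z then 1 else 0) - (a : ℂ) / d) * m i = ((∑ i ∈ Z, m i : ℕ) : ℂ) - a := by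
  have h1 : ∑ i, m i = d := by
    rw [← Finsupp.degree_eq_sum, Finsupp.degree_eq_weight_one]
    exact hf hm
  have hd' : (d : ℂ) ≠ 0 := Nat.cast_ne_zero.2 hd
  simp only [sub_mul, Finset.sum_sub_distrib, ← Finset.mul_sum, ite_mul, one_mul, zero_mul,
    Finset.sum_ite_mem, Finset.univ_inter]
  have h2 : ∑ i, (m i : ℂ) = d := by rw [← h1, Nat.cast_sum]
  rw [h2, div_mul_cancel₀ _ hd', Nat.cast_sum]

theorem lieAct_ell_of_isLimit {Z : Finset ι} {a d : ℕ} (hd : d ≠ 0) {f g : MvPolynomial ι ℂ}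
    (hf : f.IsHomogeneous d) (h : IsLimit Z a f g) : lieAct (ell Z a d) g = 0 := by
  ext m
  rw [ell, coeff_lieAct_diagonal, MvPolynomial.coeff_zero, mul_eq_zero, or_iff_not_imp_right]
  intro hg
  rw [coeff_eq_of_isLimit h] at hg
  split_ifs at hg with hz
  · rw [sum_ell_mul hd hf hg, hz, sub_self]
  · exact absurd rfl hg

theorem eq_of_lieAct_ell_eq_zero {Z : Finset ι} {a d : ℕ} (hd : d ≠ 0) {f g : MvPolynomial ι ℂ}
    (hf : f.IsHomogeneous d) (h : IsLimit Z a f g) (h0 : lieAct (ell Z a d) f = 0) : f = g := by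
  ext m
  rw [coeff_eq_of_isLimit h]
  split_ifs with hz
  · rfl
  · by_contra hm
    have h1 := congrArg (MvPolynomial.coeff m) h0
    rw [ell, coeff_lieAct_diagonal, sum_ell_mul hd hf hm, MvPolynomial.coeff_zero, mul_eq_zero,
      sub_eq_zero, Nat.cast_inj] at h1
    exact h1.elim hz hm

/-- The limit of a family of annihilators of `λ(t) · f` annihilates the leading term. -/
theorem lieAct_eq_zero_of_isLimit {Z : Finset ι} {a : ℕ} {f g : MvPolynomial ι ℂ}
    (h : IsLimit Z a f g) {A : ℂ → Matrix ι ι ℂ} (hA : Continuous A)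
    (hAf : ∀ t, t ≠ 0 → lieAct (A t) (subst (twoBlock Z t) f) = 0) : lieAct (A 0) g = 0 := by
  obtain ⟨-, D, c, hc⟩ := h
  ext m
  have hcont : ∀ p : MvPolynomial ι ℂ, Continuous fun t => (lieAct (A t) p).coeff m := fun p =>
    (LinearMap.continuous_of_finiteDimensional
      ((MvPolynomial.lcoeff ℂ m).comp (lieActAt p))).comp hA
  -- After division by t ^ a the expression extends continuously to 0, where only the term of g
  -- survives.
  have hF : Continuous fun t => (lieAct (A t) g).coeff m +
      ∑ i ∈ Finset.Ioc a D, t ^ (i - a) * (lieAct (A t) (c i)).coeff m :=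
    (hcont g).add (continuous_finsetSum _ fun i _ => (continuous_pow _).mul (hcont (c i)))
  have h0 : ∀ t : ℂ, t ≠ 0 → (lieAct (A t) g).coeff m +
      ∑ i ∈ Finset.Ioc a D, t ^ (i - a) * (lieAct (A t) (c i)).coeff m = 0 := by
    intro t ht
    have h1 := congrArg (MvPolynomial.coeff m) (hAf t ht)
    rw [hc t ht] at h1
    simp only [map_add, map_sum, Derivation.map_smul, MvPolynomial.coeff_add,
      MvPolynomial.coeff_sum, MvPolynomial.coeff_smul, MvPolynomial.coeff_zero, smul_eq_mul] at h1
    refine (mul_eq_zero.1 ?_).resolve_left (pow_ne_zero a ht)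
    rw [mul_add, Finset.mul_sum, ← h1]
    congr 1
    refine Finset.sum_congr rfl fun i hi => ?_
    rw [← mul_assoc, ← pow_add, Nat.add_sub_cancel' (Finset.mem_Ioc.1 hi).1.le]
  have h2 := congrFun (Continuous.ext_on (dense_compl_singleton (0 : ℂ)) hF continuous_const
    fun t ht => h0 t ht) 0
  rw [Finset.sum_eq_zero fun i hi => by
    rw [zero_pow (Nat.sub_pos_of_lt (Finset.mem_Ioc.1 hi).1).ne', zero_mul], add_zero] at h2
  exact h2

theorem limitStabilizer_le_lieStabilizer {Z : Finset ι} {a : ℕ} {f g : MvPolynomial ι ℂ}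
    (h : IsLimit Z a f g) : limitStabilizer Z f ≤ lieStabilizer g := by
  rintro k ⟨A, hA, rfl⟩
  exact lieAct_eq_zero_of_isLimit h (A := specialize A)
    (continuous_matrix fun i j => (A i j).continuous) hA

/-! ### The unipotent radical of `P(λ)` -/

/-- The family `u(t) · p` for `u(t) = 1 + t N`, as a polynomial in `t`. -/
def substOneAdd (N : Matrix ι ι ℂ) : MvPolynomial ι ℂ →ₐ[ℂ] Polynomial (MvPolynomial ι ℂ) :=
  MvPolynomial.aeval fun j => Polynomial.C (MvPolynomial.X j) +
    Polynomial.X * Polynomial.C (linForm N j)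

theorem eval_substOneAdd (N : Matrix ι ι ℂ) (t : ℂ) (p : MvPolynomial ι ℂ) :
    (substOneAdd N p).eval (MvPolynomial.C t) = subst (1 + t • N) p := by
  induction p using MvPolynomial.induction_on with
  | C c => simp [substOneAdd, subst]
  | add p q hp hq => rw [map_add, Polynomial.eval_add, hp, hq, map_add]
  | mul_X p j hp =>
    rw [map_mul, Polynomial.eval_mul, hp, map_mul, subst_X]
    simp [substOneAdd, linForm_add, linForm_smul, linForm_one, MvPolynomial.smul_eq_C_mul]
    exact Or.inl (mul_comm _ _)

theorem coeff_zero_substOneAdd (N : Matrix ι ι ℂ) (p : MvPolynomial ι ℂ) :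
    (substOneAdd N p).coeff 0 = p := by
  have := eval_substOneAdd N 0 p
  rwa [map_zero, zero_smul, add_zero, subst_one, AlgHom.id_apply,
    ← Polynomial.coeff_zero_eq_eval_zero] at this

theorem twoBlock_mul_one_add {Z : Finset ι} {N : Matrix ι ι ℂ} (h1 : blockProj Z * N = N)
    (h2 : N * blockProj Z = 0) (t : ℂ) :
    twoBlock Z t * (1 + N) = (1 + t • N) * twoBlock Z t := by
  rw [twoBlock_eq]
  simp only [mul_add, add_mul, one_mul, mul_one, smul_mul_assoc, mul_smul_comm, h1, h2,
    smul_zero]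
  module

/-- A unipotent element of `U(λ)` does not change the leading term. -/
theorem isLimit_subst_one_add {Z : Finset ι} {a : ℕ} {f g : MvPolynomial ι ℂ} (h : IsLimit Z a f g)
    {N : Matrix ι ι ℂ} (h1 : blockProj Z * N = N) (h2 : N * blockProj Z = 0) :
    IsLimit Z a (subst (1 + N) f) g := by
  obtain ⟨hg, D, c, hc⟩ := h
  -- λ(t)(1 + N) = (1 + tN)λ(t), so `R` is t⁻ᵃλ(t)(1 + N)f as a polynomial in t; its constant term
  -- is g.
  set R : Polynomial (MvPolynomial ι ℂ) := substOneAdd N g +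
    ∑ i ∈ Finset.Ioc a D, Polynomial.X ^ (i - a) * substOneAdd N (c i) with hR
  have hR0 : R.coeff 0 = g := by
    rw [hR, Polynomial.coeff_add, coeff_zero_substOneAdd, Polynomial.finsetSum_coeff,
      Finset.sum_eq_zero, add_zero]
    intro i hi
    rw [Polynomial.coeff_X_pow_mul', if_neg (by have := Finset.mem_Ioc.1 hi; omega)]
  refine ⟨hg, a + R.natDegree, fun i => R.coeff (i - a), fun t ht => ?_⟩
  have h3 : subst (twoBlock Z t) (subst (1 + N) f) = t ^ a • R.eval (MvPolynomial.C t) := by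
    rw [← AlgHom.comp_apply, ← subst_mul, twoBlock_mul_one_add h1 h2, subst_mul, AlgHom.comp_apply,
      hc t ht, hR, Polynomial.eval_add, Polynomial.eval_finsetSum, smul_add, Finset.smul_sum,
      map_add, map_sum, map_smul, eval_substOneAdd]
    congr 1
    refine Finset.sum_congr rfl fun i hi => ?_
    rw [Polynomial.eval_mul, Polynomial.eval_pow, Polynomial.eval_X, eval_substOneAdd, map_smul,
      ← map_pow, ← MvPolynomial.smul_eq_C_mul, smul_smul, ← pow_add,
      Nat.add_sub_cancel' (Finset.mem_Ioc.1 hi).1.le]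
  rw [h3, Polynomial.eval_eq_sum_range, Finset.sum_range_succ', smul_add, hR0, pow_zero, mul_one,
    add_comm, Finset.smul_sum]
  congr 1
  refine Finset.sum_bij (fun i _ => a + (i + 1)) ?_ ?_ ?_ ?_
  · intro i hi
    have := Finset.mem_range.1 hi
    exact Finset.mem_Ioc.2 ⟨by omega, by omega⟩
  · intro i _ j _ hij
    omega
  · intro j hj
    have := Finset.mem_Ioc.1 hj
    exact ⟨j - a - 1, Finset.mem_range.2 (by omega), by omega⟩
  · intro i _
    change _ = t ^ (a + (i + 1)) • R.coeff (a + (i + 1) - a)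
    rw [Nat.add_sub_cancel_left, mul_comm, ← map_pow, ← MvPolynomial.smul_eq_C_mul, smul_smul,
      ← pow_add]

/-- The group of all `1 + N` with `N` of weight one. -/
def upperUnipotent (Z : Finset ι) : Subgroup (Matrix.GeneralLinearGroup ι ℂ) where
  carrier := {x | blockProj Z * ((x : Matrix ι ι ℂ) - 1) = (x : Matrix ι ι ℂ) - 1 ∧
    ((x : Matrix ι ι ℂ) - 1) * blockProj Z = 0}
  one_mem' := by simp
  mul_mem' := by
    rintro x y ⟨hx, hx'⟩ ⟨hy, hy'⟩
    have h0 : ((x : Matrix ι ι ℂ) - 1) * ((y : Matrix ι ι ℂ) - 1) = 0 := by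
      rw [← hy, ← mul_assoc, hx', zero_mul]
    have h : ((x * y : Matrix.GeneralLinearGroup ι ℂ) : Matrix ι ι ℂ) - 1 =
        ((x : Matrix ι ι ℂ) - 1) + ((y : Matrix ι ι ℂ) - 1) := by
      rw [← add_zero (((x : Matrix ι ι ℂ) - 1) + _), ← h0, Units.val_mul]
      noncomm_ring
    change blockProj Z * (_ - 1) = _ - 1 ∧ (_ - 1) * blockProj Z = 0
    rw [h, mul_add, hx, hy, add_mul, hx', hy', add_zero]
    exact ⟨rfl, rfl⟩
  inv_mem' := by
    rintro x ⟨hx, hx'⟩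
    have h0 : ((x : Matrix ι ι ℂ) - 1) * ((x : Matrix ι ι ℂ) - 1) = 0 := by
      nth_rw 2 [← hx]
      rw [← mul_assoc, hx', zero_mul]
    have h : ((x⁻¹ : Matrix.GeneralLinearGroup ι ℂ) : Matrix ι ι ℂ) - 1 =
        -((x : Matrix ι ι ℂ) - 1) := by
      have h1 : (x : Matrix ι ι ℂ) * (1 - ((x : Matrix ι ι ℂ) - 1)) = 1 := by
        have h2 : (x : Matrix ι ι ℂ) * (1 - ((x : Matrix ι ι ℂ) - 1)) =
            1 - ((x : Matrix ι ι ℂ) - 1) * ((x : Matrix ι ι ℂ) - 1) := by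
          simp only [mul_sub, sub_mul, mul_one, one_mul]
          abel
        rw [h2, h0, sub_zero]
      rw [left_inv_eq_right_inv (Units.inv_mul x) h1]
      abel
    change blockProj Z * (_ - 1) = _ - 1 ∧ (_ - 1) * blockProj Z = 0
    rw [h, mul_neg, neg_mul, hx, hx', neg_zero]
    exact ⟨rfl, rfl⟩

theorem isNilpotent_of_mem_upperUnipotent {Z : Finset ι} {x : Matrix.GeneralLinearGroup ι ℂ}
    (hx : x ∈ upperUnipotent Z) : IsNilpotent ((x : Matrix ι ι ℂ) - 1) := by
  refine ⟨2, ?_⟩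
  rw [pow_two]
  nth_rw 2 [← hx.1]
  rw [← mul_assoc, hx.2, zero_mul]

theorem upperUnipotent_le_parabolic (Z : Finset ι) : upperUnipotent Z ≤ parabolic Z := by
  intro x hx
  refine ⟨1 + (0 : ℂ) • ((x : Matrix ι ι ℂ) - 1), ?_⟩
  have hc : Continuous fun t : ℂ => 1 + t • ((x : Matrix ι ι ℂ) - 1) :=
    continuous_const.add (continuous_id.smul continuous_const)
  refine ((hc.tendsto 0).mono_left nhdsWithin_le_nhds).congr' ?_
  filter_upwards [self_mem_nhdsWithin] with t ht
  have h := twoBlock_mul_one_add hx.1 hx.2 t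
  rw [add_sub_cancel] at h
  rw [conjBy, h, mul_assoc, Matrix.mul_nonsing_inv _ (isUnit_det_twoBlock Z ht), mul_one]

theorem lowPart_eq_zero_of_mem_parabolic {Z : Finset ι} {x : Matrix.GeneralLinearGroup ι ℂ}
    (hx : x ∈ parabolic Z) : lowPart Z (x : Matrix ι ι ℂ) = 0 := by
  obtain ⟨L, hL⟩ := hx
  ext i j
  rw [lowPart_apply, Matrix.zero_apply]
  split_ifs with hij
  -- An entry of weight -1 is multiplied by t⁻¹; t times the conjugate is constant there and tends
  -- to 0.
  · have h1 : Tendsto (fun t : ℂ => t * conjBy Z (x : Matrix ι ι ℂ) t i j) (𝓝[≠] 0)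
        (𝓝 (0 * L i j)) :=
      (tendsto_id.mono_left nhdsWithin_le_nhds).mul
        (((continuous_apply_apply i j).tendsto L).comp hL)
    rw [zero_mul] at h1
    refine tendsto_nhds_unique (tendsto_const_nhds.congr' ?_) h1
    filter_upwards [self_mem_nhdsWithin] with t ht
    have ht' : t ≠ 0 := ht
    rw [conjBy, Matrix.inv_eq_right_inv (twoBlock_mul_inv Z ht), twoBlock, twoBlock,
      Matrix.mul_diagonal, Matrix.diagonal_mul, if_neg hij.1, if_pos hij.2, one_mul]
    field_simp
  · rfl

/-- These 1 + N form one of the closed normal unipotent subgroups that generate the radical.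
Normality holds because P(λ) preserves range P, so a conjugate of N still maps into range P and
kills it. -/
theorem upperUnipotent_le_unipotentRadical (Z : Finset ι) :
    upperUnipotent Z ≤ unipotentRadical (parabolic Z) := by
  refine le_sSup ⟨upperUnipotent_le_parabolic Z, ?_, ?_, fun n hn =>
    isNilpotent_of_mem_upperUnipotent hn⟩
  · have hlow : ∀ x ∈ parabolic Z, (x : Matrix ι ι ℂ) * blockProj Z =
        blockProj Z * ((x : Matrix ι ι ℂ) * blockProj Z) := by
      intro x hx
      have h := lowPart_eq_zero_of_mem_parabolic hx
      rw [lowPart_eq, sub_mul, sub_mul, one_mul, sub_eq_zero, mul_assoc] at h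
      exact h
    intro x hx n hn
    have h : ((x * n * x⁻¹ : Matrix.GeneralLinearGroup ι ℂ) : Matrix ι ι ℂ) - 1 =
        (x : Matrix ι ι ℂ) * ((n : Matrix ι ι ℂ) - 1) *
          ((x⁻¹ : Matrix.GeneralLinearGroup ι ℂ) : Matrix ι ι ℂ) := by
      rw [mul_sub, sub_mul, mul_one, ← Units.val_mul x x⁻¹, mul_inv_cancel, Units.val_one,
        Units.val_mul, Units.val_mul]
    change blockProj Z * (_ - 1) = _ - 1 ∧ (_ - 1) * blockProj Z = 0
    rw [h]
    constructor
    · rw [← hn.1, ← mul_assoc (x : Matrix ι ι ℂ), hlow x hx]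
      simp only [← mul_assoc, (isIdempotentElem_blockProj Z).eq]
    · rw [mul_assoc, hlow _ (inv_mem hx), mul_assoc, ← mul_assoc _ (blockProj Z), hn.2, zero_mul,
        mul_zero]
  · refine ⟨{p | ∃ i j, (i ∉ Z ∨ j ∈ Z) ∧
      p = MvPolynomial.X (i, j) - MvPolynomial.C ((1 : Matrix ι ι ℂ) i j)}, ?_⟩
    ext x
    constructor
    · rintro ⟨h1, h2⟩ _ ⟨i, j, hij, rfl⟩
      rw [map_sub, MvPolynomial.eval_X, MvPolynomial.eval_C, ← Matrix.sub_apply]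
      rcases hij with hi | hj
      · rw [← h1, blockProj, Matrix.diagonal_mul, if_neg hi, zero_mul]
      · have := congrFun (congrFun h2 i) j
        rwa [blockProj, Matrix.mul_diagonal, if_pos hj, mul_one] at this
    · intro h
      have h' : ∀ i j, (i ∉ Z ∨ j ∈ Z) → ((x : Matrix ι ι ℂ) - 1) i j = 0 := fun i j hij => by
        have := h _ ⟨i, j, hij, rfl⟩
        rwa [map_sub, MvPolynomial.eval_X, MvPolynomial.eval_C] at this
      constructor
      · ext i j
        rw [blockProj, Matrix.diagonal_mul]
        split_ifs with hi
        · rw [one_mul]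
        · rw [zero_mul, h' i j (Or.inl hi)]
      · ext i j
        rw [blockProj, Matrix.mul_diagonal]
        split_ifs with hj
        · rw [mul_one, h' i j (Or.inr hj), Matrix.zero_apply]
        · rw [mul_zero, Matrix.zero_apply]

end Limits

/-! ### Semisimple elements of the parabolic subalgebra -/

section Main

variable {ι : Type*} [Fintype ι] [DecidableEq ι]

/-- A semisimple endomorphism that preserves the range of a projection commutes with a projection
onto this range. -/
theorem exists_projection_commute {V : Type*} [AddCommGroup V] [Module ℂ V] {P s : Module.End ℂ V}
    (hP : IsIdempotentElem P) (hs : s.IsSemisimple) (h : P * (s * P) = s * P) :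
    ∃ Q : Module.End ℂ V, P * Q = Q ∧ Q * P = P ∧ Commute s Q := by
  have hPP : ∀ v, P (P v) = P v := fun v => LinearMap.congr_fun hP v
  have hmem : LinearMap.range P ∈ s.invtSubmodule := by
    rw [Module.End.mem_invtSubmodule]
    rintro _ ⟨v, rfl⟩
    exact ⟨s (P v), LinearMap.congr_fun h v⟩
  obtain ⟨W, hW, hc⟩ := Module.End.isSemisimple_iff.1 hs _ hmem
  rw [Module.End.mem_invtSubmodule] at hmem hW
  refine ⟨(LinearMap.range P).projection W hc, ?_, ?_, ?_⟩
  · ext v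
    obtain ⟨w, hw⟩ := Submodule.projection_apply_mem hc v
    rw [Module.End.mul_apply, ← hw, hPP]
  · ext v
    exact Submodule.projection_apply_of_mem_left hc ⟨v, rfl⟩
  · ext v
    have hv : v ∈ LinearMap.range P ⊔ W := hc.sup_eq_top ▸ Submodule.mem_top
    obtain ⟨x, hx, w, hw, rfl⟩ := Submodule.mem_sup.1 hv
    have hW0 : ∀ w ∈ W, (LinearMap.range P).projection W hc w = 0 := fun w hw =>
      (Submodule.projection_apply_eq_zero_iff hc).2 hw
    simp only [Module.End.mul_apply, map_add]
    rw [Submodule.projection_apply_of_mem_left hc hx, hW0 w hw,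
      Submodule.projection_apply_of_mem_left hc (hmem hx), hW0 _ (hW hw), map_zero]

/-- A semisimple element of the parabolic subalgebra is conjugate under `U(λ)` to a matrix of
weight zero. -/
theorem exists_mem_upperUnipotent_commute {Z : Finset ι} {s : Matrix ι ι ℂ}
    (hs : Module.End.IsSemisimple (Matrix.toLin' s)) (hlow : lowPart Z s = 0) :
    ∃ u ∈ upperUnipotent Z, Commute (blockProj Z) ((u : Matrix ι ι ℂ) * s *
      ((u⁻¹ : Matrix.GeneralLinearGroup ι ℂ) : Matrix ι ι ℂ)) := by
  have hE := isIdempotentElem_blockProj Z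
  have hsE : blockProj Z * (s * blockProj Z) = s * blockProj Z := by
    rw [lowPart_eq, sub_mul, sub_mul, one_mul, sub_eq_zero, mul_assoc] at hlow
    exact hlow.symm
  obtain ⟨Q', hQ1, hQ2, hQ3⟩ := exists_projection_commute
    (P := Matrix.toLinAlgEquiv' (blockProj Z)) (s := Matrix.toLinAlgEquiv' s)
    (hE.map Matrix.toLinAlgEquiv') hs (by rw [← map_mul, ← map_mul, hsE])
  obtain ⟨Q, rfl⟩ := (Matrix.toLinAlgEquiv' (R := ℂ) (n := ι)).surjective Q'
  rw [← map_mul, EmbeddingLike.apply_eq_iff_eq] at hQ1 hQ2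
  have hsQ : s * Q = Q * s := by
    have h := hQ3.eq
    rwa [← map_mul, ← map_mul, EmbeddingLike.apply_eq_iff_eq] at h
  have hQQ : Q * Q = Q := by
    nth_rw 2 [← hQ1]
    rw [← mul_assoc, hQ2, hQ1]
  -- `Q` and P have the same range, so `N` has weight 1 and P(1 + N) = (1 + N)Q: conjugation by 1 +
  -- N carries `Q`, which commutes with `s`, to P.
  set N := Q - blockProj Z with hN
  have hN1 : blockProj Z * N = N := by rw [hN, mul_sub, hQ1, hE.eq]
  have hN2 : N * blockProj Z = 0 := by rw [hN, sub_mul, hQ2, hE.eq, sub_self]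
  have hNN : N * N = 0 := by
    nth_rw 2 [← hN1]
    rw [← mul_assoc, hN2, zero_mul]
  refine ⟨⟨1 + N, 1 - N, ?_, ?_⟩, ⟨?_, ?_⟩, ?_⟩
  · simp only [mul_sub, add_mul, mul_one, one_mul, hNN]; abel
  · simp only [sub_mul, mul_add, mul_one, one_mul, hNN]; abel
  · change blockProj Z * (1 + N - 1) = 1 + N - 1
    rw [add_sub_cancel_left, hN1]
  · change (1 + N - 1) * blockProj Z = 0
    rw [add_sub_cancel_left, hN2]
  · change blockProj Z * ((1 + N) * s * (1 - N)) = (1 + N) * s * (1 - N) * blockProj Z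
    have h1 : blockProj Z * (1 + N) = (1 + N) * Q := by
      rw [mul_add, mul_one, hN1, add_mul, one_mul, ← hQ1, ← mul_assoc, hN2, zero_mul, add_zero, hQ1,
        hN]
      abel
    have h2 : (1 - N) * blockProj Z = Q * (1 - N) := by
      rw [sub_mul, one_mul, hN2, sub_zero, mul_sub, mul_one, hN, mul_sub, hQQ, hQ2]
      abel
    rw [mul_assoc _ (1 - N), h2, ← mul_assoc, ← mul_assoc, h1, mul_assoc _ Q s, ← hsQ]
    simp only [mul_assoc]

/-- The Jordan decomposition of a matrix. -/
theorem exists_isNilpotent_isSemisimple_matrix (k : Matrix ι ι ℂ) :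
    ∃ n ∈ Algebra.adjoin ℂ {k}, ∃ s ∈ Algebra.adjoin ℂ {k}, IsNilpotent n ∧
      Module.End.IsSemisimple (Matrix.toLin' s) ∧ k = n + s := by
  let e : Matrix ι ι ℂ ≃ₐ[ℂ] Module.End ℂ (ι → ℂ) := Matrix.toLinAlgEquiv'
  obtain ⟨n, hn, s, hs, hnil, hss, hadd⟩ :=
    Module.End.exists_isNilpotent_isSemisimple (f := e k)
  have hadj : ∀ x ∈ Algebra.adjoin ℂ {e k}, e.symm x ∈ Algebra.adjoin ℂ {k} := by
    intro x hx
    have h1 := AlgHom.map_adjoin_singleton e.symm.toAlgHom (e k)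
    have h2 : e.symm x ∈ (Algebra.adjoin ℂ {e k}).map e.symm.toAlgHom := ⟨x, hx, rfl⟩
    rw [h1] at h2
    change e.symm x ∈ Algebra.adjoin ℂ {e.symm (e k)} at h2
    rwa [e.symm_apply_apply] at h2
  refine ⟨e.symm n, hadj n hn, e.symm s, hadj s hs, hnil.map e.symm, ?_, ?_⟩
  · have h : Matrix.toLin' (e.symm s) = s := e.apply_symm_apply s
    rw [h]
    exact hss
  · rw [← map_add, ← hadd, e.symm_apply_apply]

theorem lowPart_mul_eq_zero {Z : Finset ι} {x y : Matrix ι ι ℂ} (hx : lowPart Z x = 0)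
    (hy : lowPart Z y = 0) : lowPart Z (x * y) = 0 := by
  have h : ∀ z : Matrix ι ι ℂ, lowPart Z z = 0 ↔
      z * blockProj Z = blockProj Z * (z * blockProj Z) := by
    intro z
    rw [lowPart_eq, sub_mul, sub_mul, one_mul, sub_eq_zero, mul_assoc]
  rw [h] at hx hy ⊢
  rw [mul_assoc, hy, ← mul_assoc x, hx]
  simp only [← mul_assoc, (isIdempotentElem_blockProj Z).eq]

/-- A matrix of the parabolic subalgebra that annihilates `f` and is not nilpotent has a nonzero
semisimple part, which is in the parabolic subalgebra and annihilates `f`. -/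
theorem exists_semisimple_of_not_isNilpotent {Z : Finset ι} {f : MvPolynomial ι ℂ}
    {k : Matrix ι ι ℂ} (hk : k ∈ lieStabilizer f) (hlow : lowPart Z k = 0)
    (hnil : ¬ IsNilpotent k) : ∃ s ∈ lieStabilizer f, s ≠ 0 ∧ lowPart Z s = 0 ∧
      Module.End.IsSemisimple (Matrix.toLin' s) := by
  obtain ⟨n, hn, s, hs, hnn, hss, hadd⟩ := exists_isNilpotent_isSemisimple_matrix k
  have hcomm : Commute s n := Algebra.commute_of_mem_adjoin_singleton_of_commute hn
    (Algebra.commute_of_mem_adjoin_self hs).symm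
  have hf : lieAct (n + s) f = 0 := by rw [← hadd]; exact hk
  refine ⟨s, lieAct_eq_zero_of_semisimple_add_nilpotent hss hnn hcomm hf, ?_, ?_, hss⟩
  · rintro rfl
    rw [add_zero] at hadd
    exact hnil (hadd ▸ hnn)
  -- `s` is a polynomial in `k`, and the matrices without weight -1 part form an algebra.
  · clear hcomm hf hadd hss
    induction hs using Algebra.adjoin_induction with
    | mem x hx => rw [Set.mem_singleton_iff.1 hx]; exact hlow
    | algebraMap c =>
      rw [Algebra.algebraMap_eq_smul_one, map_smul, lowPart_eq, mul_one,
        (isIdempotentElem_blockProj Z).one_sub_mul_self, smul_zero]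
    | add x y _ _ hx hy => rw [map_add, hx, hy, add_zero]
    | mul x y _ _ hx hy => exact lowPart_mul_eq_zero hx hy

/-- If some annihilator of `f` in the parabolic subalgebra is not nilpotent, then a semisimple
annihilator of `f` is conjugate under `U(λ)` to an annihilator of the leading term. -/
theorem exists_common_annihilator {Z : Finset ι} {a : ℕ} (d : ℕ) {f g : MvPolynomial ι ℂ}
    (hlim : IsLimit Z a f g) {k : Matrix ι ι ℂ} (hk : k ∈ lieStabilizer f)
    (hlow : lowPart Z k = 0) (hnil : ¬ IsNilpotent k) :
    ∃ u ∈ unipotentRadical (parabolic Z),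
      IsNilpotent ((u : Matrix ι ι ℂ) - 1) ∧ IsLimit Z a (subst (u : Matrix ι ι ℂ) f) g ∧
      ∃ k ∈ lieStabilizer f, k ≠ 0 ∧
        (u : Matrix ι ι ℂ) * k * ((u⁻¹ : Matrix.GeneralLinearGroup ι ℂ) : Matrix ι ι ℂ) ∈
          lieStabilizer g ∧
        (u : Matrix ι ι ℂ) * k * ((u⁻¹ : Matrix.GeneralLinearGroup ι ℂ) : Matrix ι ι ℂ) ∈
          lieStabilizer (subst (u : Matrix ι ι ℂ) f) ∧
        (u : Matrix ι ι ℂ) * k * ((u⁻¹ : Matrix.GeneralLinearGroup ι ℂ) : Matrix ι ι ℂ) ∈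
          lieStabilizer (lieAct (ell Z a d) (subst (u : Matrix ι ι ℂ) f)) := by
  obtain ⟨s, hs, hs0, hslow, hss⟩ := exists_semisimple_of_not_isNilpotent hk hlow hnil
  obtain ⟨u, hu, hcomm⟩ := exists_mem_upperUnipotent_commute hss hslow
  have hlim' : IsLimit Z a (subst (u : Matrix ι ι ℂ) f) g := by
    have h := isLimit_subst_one_add hlim hu.1 hu.2
    rwa [add_sub_cancel] at h
  refine ⟨u, upperUnipotent_le_unipotentRadical Z hu, isNilpotent_of_mem_upperUnipotent hu, hlim',
    s, hs, hs0, ?_⟩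
  set k' := (u : Matrix ι ι ℂ) * s * ((u⁻¹ : Matrix.GeneralLinearGroup ι ℂ) : Matrix ι ι ℂ) with hk'
  have hk'u : lieAct k' (subst (u : Matrix ι ι ℂ) f) = 0 := by
    rw [← subst_lieAct (A := s), show lieAct s f = 0 from hs, map_zero]
    rw [hk', mul_assoc _ _ (u : Matrix ι ι ℂ), Units.inv_mul, mul_one]
  refine ⟨?_, hk'u, ?_⟩
  -- `k'` commutes with λ(t), so as a constant family it annihilates every λ(t)f^u.
  · refine lieAct_eq_zero_of_isLimit hlim' (A := fun _ => k') continuous_const fun t _ => ?_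
    have h : twoBlock Z t * k' = k' * twoBlock Z t := by
      rw [twoBlock_eq]
      exact ((Commute.one_left k').add_left (hcomm.smul_left (t - 1))).eq
    rw [← subst_lieAct h, hk'u, map_zero]
  · change lieAct k' _ = 0
    have h : Commute k' (ell Z a d) := by
      rw [ell_eq]
      exact hcomm.symm.sub_right ((Commute.one_right k').smul_right _)
    rw [lieAct_comm h, hk'u, map_zero]

/-! ### The nilpotent case -/

/-- By `isNilpotent_of_graded` only weight 0 matters. Such an element differs by a weight 1 matrix
from an element of 𝒦 ∩ 𝔭, which is nilpotent by assumption. -/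
theorem isNilpotent_of_mem_limitStabilizer {Z : Finset ι} {f : MvPolynomial ι ℂ}
    (hnil : ∀ k ∈ lieStabilizer f, lowPart Z k = 0 → IsNilpotent k) {k : Matrix ι ι ℂ}
    (hk : k ∈ limitStabilizer Z f) : IsNilpotent k := by
  set e : Matrix ι ι ℂ ≃ₐ[ℂ] Module.End ℂ (ι → ℂ) := Matrix.toLinAlgEquiv'
  set L : LieSubalgebra ℂ (Module.End ℂ (ι → ℂ)) :=
    (limitStabilizer Z f).map (lieEquivMatrix' (R := ℂ) (n := ι)).symm.toLieHom with hL
  have hmem : ∀ x ∈ L, ∃ y ∈ limitStabilizer Z f, e y = x := fun x hx => by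
    obtain ⟨y, hy, rfl⟩ := hx
    exact ⟨y, hy, rfl⟩
  have hmem' : ∀ y ∈ limitStabilizer Z f, e y ∈ L := fun y hy => ⟨y, hy, rfl⟩
  have hek := isNilpotent_of_graded (P := e (blockProj Z)) (L := L)
    ((isIdempotentElem_blockProj Z).map e) ?_ ?_ ?_ ?_ (e k) (hmem' k hk)
  · exact (IsNilpotent.map_iff e.injective).1 hek
  · intro x hx
    obtain ⟨y, hy, rfl⟩ := hmem x hx
    have h := hmem' _ (upPart_mem_limitStabilizer hy)
    rwa [upPart_eq, map_mul, map_mul, map_sub, map_one] at h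
  · intro x hx
    obtain ⟨y, hy, rfl⟩ := hmem x hx
    have h := hmem' _ (lowPart_mem_limitStabilizer hy)
    rwa [lowPart_eq, map_mul, map_mul, map_sub, map_one] at h
  · intro x hx
    obtain ⟨y, hy, rfl⟩ := hmem x hx
    have h := hmem' _ (midPart_mem_limitStabilizer hy)
    rwa [midPart_eq, map_add, map_mul, map_mul, map_mul, map_mul, map_sub, map_one] at h
  · intro x hx hcomm
    obtain ⟨y, hy, rfl⟩ := hmem x hx
    have hcomm' : Commute (blockProj Z) y := by
      have h := hcomm.eq
      rw [← map_mul, ← map_mul] at h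
      exact e.injective h
    obtain ⟨-, ⟨n, hn⟩, -⟩ := (mem_limitStabilizer_iff Z f y).1 hy
    rw [midPart_eq_self hcomm'] at hn
    refine (isNilpotent_of_isNilpotent_add_upPart hcomm' (hnil _ hn ?_)).map e
    rw [map_add, lowPart_upPart, ← midPart_eq_self hcomm', lowPart_midPart, add_zero]

theorem ell_notMem_limitStabilizer {Z : Finset ι} {a d : ℕ} (hd : d ≠ 0) {f g : MvPolynomial ι ℂ}
    (hf : f.IsHomogeneous d) (hlim : IsLimit Z a f g) (hfg : f ≠ g)
    (hnil : ∀ k ∈ lieStabilizer f, lowPart Z k = 0 → IsNilpotent k) :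
    ell Z a d ∉ limitStabilizer Z f := by
  intro h
  obtain ⟨r, hr⟩ := isNilpotent_of_mem_limitStabilizer hnil h
  have h0 : ell Z a d = 0 := by
    rw [ell, Matrix.diagonal_pow] at hr
    rw [ell, Matrix.diagonal_eq_zero]
    have hr' := Matrix.diagonal_eq_zero.1 hr
    exact IsReduced.eq_zero _ ⟨r, hr'⟩
  exact hfg (eq_of_lieAct_ell_eq_zero hd hf hlim (by rw [h0, lieAct_zero]; rfl))

/-- `ell` is a scalar shift of an idempotent, which is annihilated by the squarefree X(X - 1); hence
it is semisimple. -/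
theorem exists_isCompl_of_invariant_ell (Z : Finset ι) (a d : ℕ) (W : Submodule ℂ (ι → ℂ))
    (hW : ∀ x ∈ line (ell Z a d), ∀ w ∈ W, Matrix.mulVec x w ∈ W) :
    ∃ W' : Submodule ℂ (ι → ℂ), (∀ x ∈ line (ell Z a d), ∀ w ∈ W', Matrix.mulVec x w ∈ W') ∧
      IsCompl W W' := by
  set c : ℂ := (a : ℂ) / d
  have hss : Module.End.IsSemisimple (Matrix.toLinAlgEquiv' (ell Z a d)) := by
    have h1 : Matrix.toLinAlgEquiv' (ell Z a d) = Matrix.toLinAlgEquiv' (blockProj Z) -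
        algebraMap ℂ (Module.End ℂ (ι → ℂ)) c := by
      rw [ell_eq, map_sub, map_smul, map_one, Algebra.algebraMap_eq_smul_one]
    rw [h1, Module.End.isSemisimple_sub_algebraMap_iff]
    refine Module.End.isSemisimple_of_squarefree_aeval_eq_zero
      (p := Polynomial.X * (Polynomial.X - Polynomial.C 1)) ?_ ?_
    · rw [squarefree_mul_iff]
      exact ⟨IsCoprime.isRelPrime ⟨1, -1, by simp⟩, Polynomial.irreducible_X.squarefree,
        (Polynomial.irreducible_X_sub_C 1).squarefree⟩
    · have h2 := ((isIdempotentElem_blockProj Z).map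
        (Matrix.toLinAlgEquiv' (R := ℂ) (n := ι))).eq
      generalize (Matrix.toLinAlgEquiv' (R := ℂ) (n := ι)) (blockProj Z) = p at h2 ⊢
      simp [mul_sub, h2]
  have hinv : ∀ V : Submodule ℂ (ι → ℂ), V ∈ Module.End.invtSubmodule
      (Matrix.toLinAlgEquiv' (ell Z a d)) ↔ ∀ x ∈ line (ell Z a d), ∀ w ∈ V, x.mulVec w ∈ V := by
    intro V
    rw [Module.End.mem_invtSubmodule]
    constructor
    · intro h x hx w hw
      obtain ⟨b, rfl⟩ := Submodule.mem_span_singleton.1 hx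
      rw [Matrix.smul_mulVec]
      exact V.smul_mem b (h hw)
    · intro h w hw
      exact h _ (Submodule.mem_span_singleton_self _) w hw
  obtain ⟨W', hW', hc⟩ := Module.End.isSemisimple_iff.1 hss W ((hinv W).2 hW)
  exact ⟨W', (hinv W').1 hW', hc⟩

/-- 𝒦₀ and ℓ lie in ℋ, ℓ is not in 𝒦₀, and dim 𝒦₀ ≥ dim 𝒦 = dim ℋ - 1, so the sum is direct and
exhausts ℋ. -/
theorem isLeviFactorization_of_forall_isNilpotent {Z : Finset ι} {a d : ℕ} (hd : d ≠ 0)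
    {f g : MvPolynomial ι ℂ} (hf : f.IsHomogeneous d) (hlim : IsLimit Z a f g)
    (hcodim : orbitDim f = orbitDim g + 1)
    (hnil : ∀ k ∈ lieStabilizer f, lowPart Z k = 0 → IsNilpotent k) :
    IsLeviFactorization (lieStabilizer g) (limitStabilizer Z f) (line (ell Z a d)) := by
  have hell : ell Z a d ∉ limitStabilizer Z f :=
    ell_notMem_limitStabilizer hd hf hlim (by rintro rfl; omega) hnil
  have hinf : (limitStabilizer Z f).toSubmodule ⊓ (line (ell Z a d)).toSubmodule = ⊥ :=
    (Submodule.disjoint_span_singleton_of_notMem hell).eq_bot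
  have hsup : (limitStabilizer Z f).toSubmodule ⊔ (line (ell Z a d)).toSubmodule =
      (lieStabilizer g).toSubmodule := by
    refine Submodule.eq_of_le_of_finrank_le (sup_le (limitStabilizer_le_lieStabilizer hlim)
      ((Submodule.span_singleton_le_iff_mem _ _).2 (lieAct_ell_of_isLimit hd hf hlim))) ?_
    have h1 := finrank_lieStabilizer_add_orbitDim f
    have h2 := finrank_lieStabilizer_add_orbitDim g
    have h3 := finrank_lieStabilizer_le_finrank_limitStabilizer Z f
    have h4 := Submodule.finrank_sup_add_finrank_inf_eq (limitStabilizer Z f).toSubmodule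
      (line (ell Z a d)).toSubmodule
    have h5 : Module.finrank ℂ (line (ell Z a d)).toSubmodule = 1 :=
      finrank_span_singleton fun h => hell (h ▸ zero_mem _)
    rw [hinf, finrank_bot, h5] at h4
    omega
  refine ⟨hsup, hinf, ?_, fun y hy => isNilpotent_of_mem_limitStabilizer hnil hy,
    exists_isCompl_of_invariant_ell Z a d⟩
  intro x hx y hy
  have hx' : x ∈ (limitStabilizer Z f).toSubmodule ⊔ (line (ell Z a d)).toSubmodule := by
    rw [hsup]; exact hx
  obtain ⟨q, hq, z, hz, rfl⟩ := Submodule.mem_sup.1 hx'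
  obtain ⟨c, rfl⟩ := Submodule.mem_span_singleton.1 hz
  rw [add_lie, smul_lie]
  refine add_mem (LieSubalgebra.lie_mem _ hq hy) ((limitStabilizer Z f).smul_mem c ?_)
  -- ad ℓ = ad P, since the scalar part is central; the graded 𝒦₀ is stable under it.
  have h : ⁅ell Z a d, y⁆ = upPart Z y - lowPart Z y := by
    rw [← lie_blockProj, ell_eq, sub_lie, Ring.lie_def ((_ : ℂ) • (1 : Matrix ι ι ℂ)),
      smul_mul_assoc, mul_smul_comm, one_mul, mul_one, sub_self, sub_zero]
  rw [h]
  exact sub_mem (upPart_mem_limitStabilizer hy) (lowPart_mem_limitStabilizer hy)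

/-- Nilpotent matrices have nilpotent adjoint action, so Engel's theorem applies. -/
theorem isNilpotent_limitStabilizer {Z : Finset ι} {f : MvPolynomial ι ℂ}
    (hnil : ∀ k ∈ lieStabilizer f, lowPart Z k = 0 → IsNilpotent k) :
    LieRing.IsNilpotent (limitStabilizer Z f) := by
  rw [LieAlgebra.isNilpotent_iff_forall (R := ℂ)]
  intro x
  exact LieSubalgebra.isNilpotent_ad_of_isNilpotent_ad _
    (LieAlgebra.ad_nilpotent_of_nilpotent (isNilpotent_of_mem_limitStabilizer hnil x.2))

end Main

end FormLimits

end

/-! ### The dichotomy -/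

theorem mainTheorem10 {ι : Type*} [Fintype ι] [DecidableEq ι] (Z : Finset ι) (d a : ℕ)
    (f g : MvPolynomial ι ℂ) (hf : f.IsHomogeneous d)
    (hred : FormLimits.IsReductive (FormLimits.groupStabilizer f))
    (hlim : FormLimits.IsLimit Z a f g)
    (hcodim : FormLimits.orbitDim f = FormLimits.orbitDim g + 1) :
    (LieRing.IsNilpotent (FormLimits.limitStabilizer Z f) ∧
      FormLimits.IsLeviFactorization (FormLimits.lieStabilizer g)
        (FormLimits.limitStabilizer Z f) (FormLimits.line (FormLimits.ell Z a d))) ∨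
    (∃ u ∈ FormLimits.unipotentRadical (FormLimits.parabolic Z),
      IsNilpotent ((u : Matrix ι ι ℂ) - 1) ∧
      FormLimits.IsLimit Z a (FormLimits.subst (u : Matrix ι ι ℂ) f) g ∧
      ∃ k ∈ FormLimits.lieStabilizer f, k ≠ 0 ∧
        (u : Matrix ι ι ℂ) * k * ((u⁻¹ : Matrix.GeneralLinearGroup ι ℂ) : Matrix ι ι ℂ) ∈
          FormLimits.lieStabilizer g ∧
        (u : Matrix ι ι ℂ) * k * ((u⁻¹ : Matrix.GeneralLinearGroup ι ℂ) : Matrix ι ι ℂ) ∈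
          FormLimits.lieStabilizer (FormLimits.subst (u : Matrix ι ι ℂ) f) ∧
        (u : Matrix ι ι ℂ) * k * ((u⁻¹ : Matrix.GeneralLinearGroup ι ℂ) : Matrix ι ι ℂ) ∈
          FormLimits.lieStabilizer (FormLimits.lieAct (FormLimits.ell Z a d)
            (FormLimits.subst (u : Matrix ι ι ℂ) f))) := by
  have hd : d ≠ 0 := by
    rintro rfl
    rw [FormLimits.orbitDim_eq_zero_of_isHomogeneous_zero hf] at hcodim
    omega
  -- `lowPart Z k = 0` says that `k` lies in the Lie algebra of P(λ).
  by_cases hnil : ∀ k ∈ FormLimits.lieStabilizer f, FormLimits.lowPart Z k = 0 → IsNilpotent k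
  · exact Or.inl ⟨FormLimits.isNilpotent_limitStabilizer hnil,
      FormLimits.isLeviFactorization_of_forall_isNilpotent hd hf hlim hcodim hnil⟩
  · push Not at hnil
    obtain ⟨k, hk, hlow, hk'⟩ := hnil
    exact Or.inr (FormLimits.exists_common_annihilator d hlim hk hlow hk')
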